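/- Let $L,U,\nu>0$, $J\ge 1$, $0<\tau\le T^*:=L/U$, $\Omega=(0,L)^3$, and let $u_1,\dots,u_J$ be a weak solution on $[0,\infty)$ of the ensemble eddy viscosity model $$\partial_t u_j+u_j\cdot\nabla u_j-\nu\Delta u_j-\nabla\cdot(\nu_{turb}\nabla u_j)+\nabla p_j=0,\quad \nabla\cdot u_j=0\ \text{ in }\Omega,\quad u_j(\cdot,0)=u_j^0\in L^2(\Omega),\ \nabla\cdot u_j^0=0,$$ with shear boundary conditions: $u_j$ is $L$-periodic in $x$ and $y$, $u_j=(0,0,0)$ on $z=0$ and $u_j=(U,0,0)$ on $z=L$. Here $\nu_{turb}=\mu\,\tau\,|u'|_e^2$, where $\langle a\rangle_e=\frac1J\sum_{j=1}^J a_j$, $u_j'=u_j-\langle u\rangle_e$, $|u'|_e^2=\frac1J\sum_j|u_j'|^2$. Weak solution means that, for every $T>0$, $u_j\in L^\infty(0,T;L^2(\Omega))\cap L^2(0,T;H^1(\Omega))$ and $\nu_{turb}|\nabla u_j|^2\in L^1((0,T)\times\Omega)$, the divergence and boundary conditions hold for a.e. $t$ (boundary values in the trace sense), and the momentum equation with the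 initial condition holds when tested against smooth divergence free fields that are $L$-periodic in $x,y$ and vanish near the walls and for large times. Assume that each realization satisfies the energy inequality: for every divergence free $\phi=\phi(x,y,z)$ with $\phi,\nabla\phi\in L^2(\Omega)$ and the same boundary conditions, for which the integrals on the right-hand side make sense, and for a.e. $T>0$, $$\tfrac12\|u_j(T)\|^2-\tfrac12\|u_j^0\|^2+\int_0^T\!\!\int_\Omega[\nu+\nu_{turb}]|\nabla u_j|^2\,dx\,dt\le (u_j(T)-u_j^0,\phi)+\int_0^T\!\!\int_\Omega[\nu+\nu_{turb}]\nabla u_j:\nabla\phi\,dx\,dt+\int_0^T(u_j\cdot\nabla u_j,\phi)\,dt .$$ Put $\langle f\rangle_\infty=\limsup_{T\to\infty}\frac1T\int_0^T f\,dt$, $$\varepsilon_{model}(t)=\Big\langle\frac1{|\Omega|}\int_\Omega[\nu+\nu_{turb}]|\nabla u|^2dx\Big\rangle_e,\quad \nu_{eff}=\frac{\langle\varepsilon_{model}\rangle_\infty}{\big\langle\big\langle\frac1{|\Omega|}\int_\Omega|\nabla u|^2dx\big\rangle_e\big\rangle_\infty},\quad Re=\frac{UL}{\nu},\quad Re_{eff}=\frac{UL}{\nu_{eff}},\quad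 \beta=\tfrac18Re_{eff}^{-1},$$ and $\mathcal S_\beta=\{(x,y,z):0\le x\le L,\ 0\le y\le L,\ (1-\beta)L<z<L\}$; assume that the slab $\mathcal S_\beta$ fits in the flow region, i.e. $\beta\le1$. Suppose that $\mu=\mu(x,y,z)$ equals a constant $\mu_\beta\ge0$ in $\mathcal S_\beta$ and a constant $\mu_0\ge0$ in the rest of $\Omega$. If $\mu_\beta\le 0.27064\,Re^{-1}$, then $$\langle\varepsilon_{model}\rangle_\infty\le\Big(5+32\frac{\nu}{\nu_{eff}}\Big)\frac{U^3}{L}\le 37\,\frac{U^3}{L}.$$ -/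

import Mathlib

open MeasureTheory Filter Topology
open scoped ContDiff

namespace ShearEEV

/-- Points and vectors of `ℝ³`, in coordinates `(x, y, z) = (x 0, x 1, x 2)`. Every Euclidean
length below is written out as a sum of squares of coordinates. -/
abbrev R3 : Type := Fin 3 → ℝ

/-- A `3 × 3` array; for a gradient, the entry `i k` is `∂ₖ uᵢ`. -/
abbrev M3 : Type := Fin 3 → Fin 3 → ℝ

/-- Euclidean inner product on `ℝ³`. -/
def dot (a b : R3) : ℝ := ∑ i, a i * b i

/-- Frobenius product `A : B`. -/
def frob (A B : M3) : ℝ := ∑ i, ∑ k, A i k * B i k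

/-- The vector `(a · ∇) v`, where `D = ∇v`. -/
def convect (a : R3) (D : M3) : R3 := fun i => ∑ k, a k * D i k

/-- The flow domain `Ω = (0, L)³`. -/
def box (L : ℝ) : Set R3 := {x | ∀ i, 0 < x i ∧ x i < L}

/-- The upper near wall slab
`S_β = {0 ≤ x ≤ L, 0 ≤ y ≤ L, (1 - β) L < z < L}`. -/
def nearWall (L β : ℝ) : Set R3 :=
  {x | (0 ≤ x 0 ∧ x 0 ≤ L) ∧ (0 ≤ x 1 ∧ x 1 ≤ L) ∧ ((1 - β) * L < x 2 ∧ x 2 < L)}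

/-! ### Function spaces -/

/-- Classical Jacobian: entry `i k` is `∂ₖ fᵢ (x)`. -/
noncomputable def jac (f : R3 → R3) (x : R3) : M3 :=
  fun i k => fderiv ℝ f x (Pi.single k 1) i

/-- `L`-periodicity in `x` and `y`. -/
def PeriodicXY (L : ℝ) (f : R3 → R3) : Prop :=
  ∀ x, f (x + Pi.single 0 L) = f x ∧ f (x + Pi.single 1 L) = f x

/-- `f` vanishes in a neighbourhood of the walls `z = 0` and `z = L` (and beyond them). -/
def VanishesNearWalls (L : ℝ) (f : R3 → R3) : Prop :=
  ∃ a b : ℝ, 0 < a ∧ b < L ∧ ∀ x : R3, (x 2 ≤ a ∨ b ≤ x 2) → f x = 0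

/-- `w ∈ H¹(Ω)³` is `L`-periodic in `x, y`, has zero trace on the walls `z = 0, L`, and has
gradient `Dw`: the pair `(w, Dw)` is the `L²(Ω)` limit of pairs `(f, ∇f)` with `f` smooth,
`L`-periodic in `x, y` and vanishing near the walls. -/
def IsH1ZeroWalls (L : ℝ) (w : R3 → R3) (Dw : R3 → M3) : Prop :=
  MemLp w 2 (volume.restrict (box L)) ∧ MemLp Dw 2 (volume.restrict (box L)) ∧
  ∃ f : ℕ → R3 → R3,
    (∀ n, ContDiff ℝ ∞ (f n) ∧ PeriodicXY L (f n) ∧ VanishesNearWalls L (f n)) ∧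
    Tendsto (fun n => eLpNorm (fun x => f n x - w x) 2 (volume.restrict (box L))) atTop (𝓝 0) ∧
    Tendsto (fun n => eLpNorm (fun x => jac (f n) x - Dw x) 2 (volume.restrict (box L)))
      atTop (𝓝 0)

/-- The smooth field `(U z / L, 0, 0)`, which has the shear boundary values. -/
noncomputable def linearShear (L U : ℝ) (x : R3) : R3 := ![U * x 2 / L, 0, 0]

/-- `v ∈ H¹(Ω)³` has gradient `Dv` and satisfies the shear boundary conditions in the trace
sense: `v = (0, 0, 0)` on `z = 0`, `v = (U, 0, 0)` on `z = L`, `L`-periodic in `x, y`. -/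
def IsH1Shear (L U : ℝ) (v : R3 → R3) (Dv : R3 → M3) : Prop :=
  IsH1ZeroWalls L (fun x => v x - linearShear L U x) (fun x => Dv x - jac (linearShear L U) x)

/-- The field with gradient `Dv` is divergence free in `Ω`. -/
def DivFree (L : ℝ) (Dv : R3 → M3) : Prop :=
  ∀ᵐ x ∂(volume.restrict (box L)), ∑ i, Dv x i i = 0

/-- An `L²` field is divergence free in `Ω` in the sense of distributions. -/
def WeakDivFree (L : ℝ) (v : R3 → R3) : Prop :=
  ∀ p : R3 → ℝ, ContDiff ℝ ∞ p → HasCompactSupport p → tsupport p ⊆ box L →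
    ∫ x in box L, ∑ i, v x i * fderiv ℝ p x (Pi.single i 1) = 0

/-! ### The ensemble model -/

section Model

variable {J : ℕ}

/-- Ensemble average of a real quantity. -/
noncomputable def ensAvg (a : Fin J → ℝ) : ℝ := (1 / (J : ℝ)) * ∑ j, a j

/-- Fluctuation `u'_j = u_j - ⟨u⟩_e`. -/
noncomputable def fluct (u : Fin J → ℝ → R3 → R3) (j : Fin J) (t : ℝ) (x : R3) : R3 :=
  fun i => u j t x i - ensAvg fun m => u m t x i

/-- `|u'|_e² = (1/J) ∑_j |u'_j|²`. -/
noncomputable def fluctSq (u : Fin J → ℝ → R3 → R3) (t : ℝ) (x : R3) : ℝ :=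
  ensAvg fun j => dot (fluct u j t x) (fluct u j t x)

/-- Turbulent viscosity `ν_turb = μ τ |u'|_e²`, with a coefficient `μ = μ(x)`. -/
noncomputable def nuTurb (μ : R3 → ℝ) (τ : ℝ) (u : Fin J → ℝ → R3 → R3) (t : ℝ) (x : R3) : ℝ :=
  μ x * τ * fluctSq u t x

open Classical in
/-- The coefficient equal to `μβ` in the slab `S_β` and to `μ₀` elsewhere. -/
noncomputable def muWall (L β μ₀ μβ : ℝ) (x : R3) : ℝ := if x ∈ nearWall L β then μβ else μ₀

/-- Divergence free test fields on `[0, ∞) × Ω`: smooth, `L`-periodic in `x, y`, vanishing near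
the walls and for large times. -/
def IsTestField (L : ℝ) (ψ : ℝ → R3 → R3) : Prop :=
  ContDiff ℝ ∞ (fun p : ℝ × R3 => ψ p.1 p.2) ∧
  (∀ t, PeriodicXY L (ψ t)) ∧
  (∃ a b : ℝ, 0 < a ∧ b < L ∧ ∀ t, ∀ x : R3, (x 2 ≤ a ∨ b ≤ x 2) → ψ t x = 0) ∧
  (∃ T₀ : ℝ, ∀ t, T₀ ≤ t → ∀ x, ψ t x = 0) ∧
  ∀ t x, ∑ i, jac (ψ t) x i i = 0

/-- `u = (u_j)`, with spatial gradients `Du = (∇u_j)` and initial data `u0 = (u_j⁰)`, is a weak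
solution on `[0, ∞)` of the ensemble eddy viscosity model with shear boundary conditions:
`∂ₜu + u·∇u - ν Δu - ∇·(ν_turb ∇u) + ∇p = 0`, `∇·u = 0`, for each realization `j`. -/
structure IsWeakSolution (L U ν τ : ℝ) (μ : R3 → ℝ) (u0 : Fin J → R3 → R3)
    (u : Fin J → ℝ → R3 → R3) (Du : Fin J → ℝ → R3 → M3) : Prop where
  initial_memLp : ∀ j, MemLp (u0 j) 2 (volume.restrict (box L))
  initial_divFree : ∀ j, WeakDivFree L (u0 j)
  /-- `u_j ∈ L²(0,T; L²(Ω))` -/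
  memLp : ∀ j, ∀ T > 0, MemLp (fun p : ℝ × R3 => u j p.1 p.2) 2
    (volume.restrict (Set.Ioo 0 T ×ˢ box L))
  /-- `∇u_j ∈ L²(0,T; L²(Ω))` -/
  grad_memLp : ∀ j, ∀ T > 0, MemLp (fun p : ℝ × R3 => Du j p.1 p.2) 2
    (volume.restrict (Set.Ioo 0 T ×ˢ box L))
  /-- `u_j ∈ L^∞(0,T; L²(Ω))` -/
  energy_bdd : ∀ j, ∀ T > 0, ∃ C : ℝ, ∀ᵐ t ∂(volume.restrict (Set.Ioo 0 T)),
    ∫ x in box L, dot (u j t x) (u j t x) ≤ C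
  /-- `ν_turb |∇u_j|² ∈ L¹((0,T) × Ω)` -/
  turb_integrable : ∀ j, ∀ T > 0, IntegrableOn
    (fun p : ℝ × R3 => nuTurb μ τ u p.1 p.2 * frob (Du j p.1 p.2) (Du j p.1 p.2))
    (Set.Ioo 0 T ×ˢ box L)
  /-- `Du_j(t)` is the gradient of `u_j(t)`, and the boundary conditions hold -/
  shear : ∀ j, ∀ᵐ t ∂(volume.restrict (Set.Ioi 0)), IsH1Shear L U (u j t) (Du j t)
  divFree : ∀ j, ∀ᵐ t ∂(volume.restrict (Set.Ioi (0 : ℝ))), DivFree L (Du j t)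
  /-- the momentum equation, with the initial condition -/
  momentum : ∀ j, ∀ ψ : ℝ → R3 → R3, IsTestField L ψ →
    (∫ t in Set.Ioi (0 : ℝ), ∫ x in box L,
      (-dot (u j t x) (deriv (fun s => ψ s x) t)
        + dot (convect (u j t x) (Du j t x)) (ψ t x)
        + (ν + nuTurb μ τ u t x) * frob (Du j t x) (jac (ψ t) x)))
      = ∫ x in box L, dot (u0 j x) (ψ 0 x)

/-- The energy inequality for every realization, integrated over `[0, T]`: for every divergence
free `φ ∈ H¹(Ω)³` with the shear boundary conditions, for which the integrals on the right make
sense, and for almost every `T > 0`,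
`½‖u(T)‖² - ½‖u⁰‖² + ∫₀ᵀ∫ [ν + ν_turb] |∇u|²
  ≤ (u(T) - u⁰, φ) + ∫₀ᵀ∫ [ν + ν_turb] ∇u : ∇φ + ∫₀ᵀ (u·∇u, φ)`. -/
def EnergyInequality (L U ν τ : ℝ) (μ : R3 → ℝ) (u0 : Fin J → R3 → R3)
    (u : Fin J → ℝ → R3 → R3) (Du : Fin J → ℝ → R3 → M3) : Prop :=
  ∀ j, ∀ (φ : R3 → R3) (Dφ : R3 → M3), IsH1Shear L U φ Dφ → DivFree L Dφ →
    (∀ T > 0, IntegrableOn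
      (fun p : ℝ × R3 => (ν + nuTurb μ τ u p.1 p.2) * frob (Du j p.1 p.2) (Dφ p.2))
      (Set.Ioo 0 T ×ˢ box L)) →
    (∀ T > 0, IntegrableOn
      (fun p : ℝ × R3 => dot (convect (u j p.1 p.2) (Du j p.1 p.2)) (φ p.2))
      (Set.Ioo 0 T ×ˢ box L)) →
    ∀ᵐ T ∂(volume.restrict (Set.Ioi (0 : ℝ))),
      (1 / 2) * (∫ x in box L, dot (u j T x) (u j T x))
        - (1 / 2) * (∫ x in box L, dot (u0 j x) (u0 j x))
        + (∫ t in (0 : ℝ)..T, ∫ x in box L,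
            (ν + nuTurb μ τ u t x) * frob (Du j t x) (Du j t x))
      ≤ (∫ x in box L, dot (u j T x) (φ x)) - (∫ x in box L, dot (u0 j x) (φ x))
        + (∫ t in (0 : ℝ)..T, ∫ x in box L,
            (ν + nuTurb μ τ u t x) * frob (Du j t x) (Dφ x))
        + (∫ t in (0 : ℝ)..T, ∫ x in box L,
            dot (convect (u j t x) (Du j t x)) (φ x))

/-! ### Averages and derived quantities -/

/-- `⟨f⟩_∞ = limsup_{T → ∞} (1/T) ∫₀ᵀ f dt`, with values in `[-∞, ∞]`. -/
noncomputable def longTimeAvg (f : ℝ → ℝ) : EReal :=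
  limsup (fun T : ℝ => (((1 / T) * ∫ t in (0 : ℝ)..T, f t : ℝ) : EReal)) atTop

/-- `ε_model(t) = ⟨ |Ω|⁻¹ ∫_Ω [ν + ν_turb] |∇u|² dx ⟩_e`, where `|Ω| = L³`. -/
noncomputable def epsModel (L ν τ : ℝ) (μ : R3 → ℝ) (u : Fin J → ℝ → R3 → R3)
    (Du : Fin J → ℝ → R3 → M3) (t : ℝ) : ℝ :=
  ensAvg fun j => (1 / L ^ 3) * ∫ x in box L,
    (ν + nuTurb μ τ u t x) * frob (Du j t x) (Du j t x)

/-- `⟨ |Ω|⁻¹ ∫_Ω |∇u|² dx ⟩_e`. -/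
noncomputable def gradSq (L : ℝ) (Du : Fin J → ℝ → R3 → M3) (t : ℝ) : ℝ :=
  ensAvg fun j => (1 / L ^ 3) * ∫ x in box L, frob (Du j t x) (Du j t x)

/-- Effective viscosity: the ratio of the long time averages of `ε_model` and of
`⟨ |Ω|⁻¹ ∫_Ω |∇u|² dx ⟩_e`. -/
noncomputable def nuEff (L ν τ : ℝ) (μ : R3 → ℝ) (u : Fin J → ℝ → R3 → R3)
    (Du : Fin J → ℝ → R3 → M3) : ℝ :=
  (longTimeAvg (epsModel L ν τ μ u Du)).toReal / (longTimeAvg (gradSq L Du)).toReal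

end Model

/-- Reynolds number `U L / κ` for the viscosity `κ`. -/
noncomputable def reynolds (L U κ : ℝ) : ℝ := U * L / κ

end ShearEEV

/-! The energy inequality is tested with a background shear (Φ(z), 0, 0) whose slope g ≥ 0 lives
above a height a and has integral U; `isH1Shear_shearField` makes it admissible. Everything is then
measured against the velocity of the upper wall. Integration by parts (`integral_convect`) turns the
convective term into an integral of g times a product of components of v minus the wall velocity.
The turbulent viscosity is bounded by the same difference, because the ensemble mean minimises the
mean square deviation (`fluctSq_le`). A weighted Poincaré inequality (`integral_weight_dot_le`)
bounds the integral of ρ(z)|v - wall velocity|² by ∫ρ(z)(L - z)dz times ∫|∇v|². Together with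
Young's inequality (`integral_cross_le`) this gives `energy_bound`: half of the integrated
dissipation is at most a constant, plus a term linear in T, plus -ν/4 + ½∫g(L - z) + ½mτ∫g²(L - z)
times the integrated squared gradient, where m bounds μ above height a.

This estimate is used twice. A logarithmic profile over the full height makes both weighted
integrals as small as desired, so the mean dissipation is finite for every bounded μ. This has to
come first: an infinite dissipation has real part 0, which would give β = 0 and an empty slab. A
linear profile cannot do it, since its ∫g²(L - z) equals U²/2 whatever its width.

The linear profile in the slab then gives the constants. There the smallness of μβ lets -ν/4 absorb
the turbulent term, and the mean dissipation e and mean squared gradient d satisfy e ≤ (UβL/2)d +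
2νU²/(βL²). Since e = ν_eff d and β = ν_eff/(8UL), the first term is e/16 and the second is
16(ν/ν_eff)U³/L. Hence e ≤ (256/15)(ν/ν_eff)U³/L, which is below the claimed bound; ν ≤ ν_eff gives
the absolute constant. -/

namespace ShearEEV

/-! ### Convergence in `L²` -/

/-- `Aₙ → A` in `L²(μ)`. -/
def L2Conv {α : Type*} [MeasurableSpace α] (μ : Measure α) (An : ℕ → α → ℝ) (A : α → ℝ) : Prop :=
  (∀ n, MemLp (An n) 2 μ) ∧ MemLp A 2 μ ∧
    Tendsto (fun n => eLpNorm (fun x => An n x - A x) 2 μ) atTop (𝓝 0)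

namespace L2Conv

variable {α : Type*} [MeasurableSpace α] {μ : Measure α} {An Bn : ℕ → α → ℝ} {A B : α → ℝ}

theorem const (hA : MemLp A 2 μ) : L2Conv μ (fun _ => A) A :=
  ⟨fun _ => hA, hA, by simp⟩

theorem add (hA : L2Conv μ An A) (hB : L2Conv μ Bn B) :
    L2Conv μ (fun n x => An n x + Bn n x) (fun x => A x + B x) := by
  refine ⟨fun n => (hA.1 n).add (hB.1 n), hA.2.1.add hB.2.1, ?_⟩
  have h := hA.2.2.add hB.2.2
  rw [add_zero] at h
  refine tendsto_of_tendsto_of_tendsto_of_le_of_le tendsto_const_nhds h (fun _ => zero_le) ?_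
  intro n
  have := eLpNorm_add_le (p := 2) (((hA.1 n).sub hA.2.1).aestronglyMeasurable)
    (((hB.1 n).sub hB.2.1).aestronglyMeasurable) (by norm_num)
  have e : (fun x => An n x + Bn n x - (A x + B x)) = (An n - A) + (Bn n - B) := by
    ext x
    simp only [Pi.add_apply, Pi.sub_apply]
    ring
  beta_reduce
  rw [e]
  exact this

theorem bdd_mul (hA : L2Conv μ An A) {c : α → ℝ} (hc : AEStronglyMeasurable c μ) {C : ℝ}
    (hC : ∀ᵐ x ∂μ, |c x| ≤ C) : L2Conv μ (fun n x => c x * An n x) (fun x => c x * A x) := by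
  have key : ∀ f : α → ℝ, eLpNorm (fun x => c x * f x) 2 μ ≤ ENNReal.ofReal C * eLpNorm f 2 μ := by
    intro f
    refine eLpNorm_le_mul_eLpNorm_of_ae_le_mul ?_ 2
    filter_upwards [hC] with x hx
    rw [norm_mul]
    exact mul_le_mul_of_nonneg_right hx (norm_nonneg _)
  have mem : ∀ f : α → ℝ, MemLp f 2 μ → MemLp (fun x => c x * f x) 2 μ := fun f hf =>
    ⟨hc.mul hf.1, (key f).trans_lt (ENNReal.mul_lt_top ENNReal.ofReal_lt_top hf.2)⟩
  refine ⟨fun n => mem _ (hA.1 n), mem _ hA.2.1, ?_⟩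
  have h := ENNReal.Tendsto.const_mul (a := ENNReal.ofReal C) hA.2.2 (Or.inr ENNReal.ofReal_ne_top)
  rw [mul_zero] at h
  refine tendsto_of_tendsto_of_tendsto_of_le_of_le tendsto_const_nhds h (fun _ => zero_le) ?_
  intro n
  have e : (fun x => c x * An n x - c x * A x) = fun x => c x * (An n x - A x) := by
    ext x
    ring
  beta_reduce
  rw [e]
  exact key _

/-- Continuity of the inner product of L². Identities and inequalities quadratic in a field and its
gradient pass from smooth approximants to H¹ fields through this. -/
theorem integral_mul (hA : L2Conv μ An A) (hB : L2Conv μ Bn B) :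
    Tendsto (fun n => ∫ x, An n x * Bn n x ∂μ) atTop (𝓝 (∫ x, A x * B x ∂μ)) := by
  have tA := (Lp.tendsto_Lp_iff_tendsto_eLpNorm'' An hA.1 A hA.2.1).2 hA.2.2
  have tB := (Lp.tendsto_Lp_iff_tendsto_eLpNorm'' Bn hB.1 B hB.2.1).2 hB.2.2
  have key : ∀ {f g : α → ℝ} (hf : MemLp f 2 μ) (hg : MemLp g 2 μ),
      inner ℝ (hf.toLp f) (hg.toLp g) = ∫ x, f x * g x ∂μ := by
    intro f g hf hg
    rw [L2.inner_def]
    refine integral_congr_ae ?_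
    filter_upwards [hf.coeFn_toLp, hg.coeFn_toLp] with x h1 h2
    simp [h1, h2, mul_comm]
  have := tA.inner tB (𝕜 := ℝ)
  simpa only [key] using this

theorem integral_bdd_mul_mul (hA : L2Conv μ An A) (hB : L2Conv μ Bn B) {c : α → ℝ}
    (hc : AEStronglyMeasurable c μ) {C : ℝ} (hC : ∀ᵐ x ∂μ, |c x| ≤ C) :
    Tendsto (fun n => ∫ x, c x * An n x * Bn n x ∂μ) atTop (𝓝 (∫ x, c x * A x * B x ∂μ)) :=
  (hA.bdd_mul hc hC).integral_mul hB

end L2Conv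

/-! ### The box -/

theorem box_eq_pi (L : ℝ) : box L = Set.univ.pi fun _ => Set.Ioo 0 L := by
  ext x; simp [box, Set.mem_pi]

theorem measurableSet_box (L : ℝ) : MeasurableSet (box L) := by
  rw [box_eq_pi]; exact MeasurableSet.univ_pi fun _ => measurableSet_Ioo

theorem box_subset_Icc (L : ℝ) : box L ⊆ Set.Icc (fun _ => 0) (fun _ => L) :=
  fun _ hx => ⟨fun i => (hx i).1.le, fun i => (hx i).2.le⟩

theorem restrict_box (L : ℝ) :
    (volume : Measure R3).restrict (box L) =
      Measure.pi fun _ => (volume : Measure ℝ).restrict (Set.Ioo 0 L) := by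
  rw [box_eq_pi, volume_pi, Measure.restrict_pi_pi]

instance (L : ℝ) : IsFiniteMeasure ((volume : Measure R3).restrict (box L)) := by
  rw [restrict_box]; infer_instance

theorem volume_real_box {L : ℝ} (hL : 0 ≤ L) : (volume : Measure R3).real (box L) = L ^ 3 := by
  rw [box_eq_pi, measureReal_def, volume_pi, Measure.pi_pi]
  simp [hL]

/-- The image of Lebesgue measure on the box under the height function. -/
theorem map_height_box {L : ℝ} :
    ((volume : Measure R3).restrict (box L)).map (fun x => x 2) =
      ENNReal.ofReal L ^ 2 • (volume : Measure ℝ).restrict (Set.Ioo 0 L) := by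
  rw [restrict_box]
  have := Measure.pi_map_eval (fun _ : Fin 3 => (volume : Measure ℝ).restrict (Set.Ioo 0 L)) 2
  refine (this.trans ?_)
  congr 1
  simp

theorem integral_height {L : ℝ} (hL : 0 ≤ L) {F : ℝ → ℝ}
    (hF : AEStronglyMeasurable F (volume.restrict (Set.Ioo 0 L))) :
    ∫ x in box L, F (x 2) = L ^ 2 * ∫ z in (0 : ℝ)..L, F z := by
  have hm : AEMeasurable (fun x : R3 => x 2) (volume.restrict (box L)) :=
    (measurable_pi_apply 2).aemeasurable
  have h := integral_map (f := F) hm (by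
    rw [map_height_box]; exact hF.smul_measure _)
  rw [← h, map_height_box, integral_smul_measure, intervalIntegral.integral_of_le hL,
    integral_Ioc_eq_integral_Ioo]
  simp [hL]

theorem eLpNorm_height {L : ℝ} {F : ℝ → ℝ}
    (hF : AEStronglyMeasurable F (volume.restrict (Set.Ioo 0 L))) :
    eLpNorm (fun x : R3 => F (x 2)) 2 (volume.restrict (box L)) =
      (ENNReal.ofReal L ^ 2) ^ (1 / 2 : ℝ) * eLpNorm F 2 (volume.restrict (Set.Ioo 0 L)) := by
  have hm : AEMeasurable (fun x : R3 => x 2) (volume.restrict (box L)) :=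
    (measurable_pi_apply 2).aemeasurable
  have h := eLpNorm_map_measure (p := 2) (g := F) (f := fun x : R3 => x 2)
    (μ := volume.restrict (box L)) (by
      rw [map_height_box]; exact hF.smul_measure _) hm
  rw [map_height_box] at h
  rw [show (fun x : R3 => F (x 2)) = F ∘ (fun x : R3 => x 2) from rfl, ← h,
    eLpNorm_smul_measure_of_ne_top (by norm_num)]
  simp

theorem exists_bound_box {L : ℝ} {f : R3 → ℝ} (hf : Continuous f) :
    ∃ C, ∀ x ∈ box L, |f x| ≤ C := by
  obtain ⟨C, hC⟩ := (isCompact_Icc (a := (fun _ => 0 : R3)) (b := fun _ => L)).exists_bound_of_continuousOn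
    hf.continuousOn
  exact ⟨C, fun x hx => hC x (box_subset_Icc L hx)⟩

theorem memLp_box_of_continuous {L : ℝ} {f : R3 → ℝ} (hf : Continuous f) :
    MemLp f 2 (volume.restrict (box L)) := by
  obtain ⟨C, hC⟩ := exists_bound_box (L := L) hf
  exact MemLp.of_bound hf.aestronglyMeasurable C
    ((ae_restrict_iff' (measurableSet_box L)).2 (ae_of_all _ hC))

/-! ### Smooth approximation of fields with shear boundary values -/

theorem jac_continuous {f : R3 → R3} (hf : ContDiff ℝ ∞ f) (i k : Fin 3) :
    Continuous fun x => jac f x i k := by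
  have := (hf.continuous_fderiv (by simp)).clm_apply (continuous_const (y := (Pi.single k 1 : R3)))
  exact (continuous_apply i).comp this

theorem linearShear_contDiff (L U : ℝ) : ContDiff ℝ ∞ (linearShear L U) := by
  rw [contDiff_pi]
  intro i
  fin_cases i
  · simp only [linearShear]
    exact ((contDiff_const.mul (contDiff_apply ℝ ℝ (2 : Fin 3)))).div_const L
  · exact contDiff_const
  · exact contDiff_const

theorem jac_add {f g : R3 → R3} (hf : ContDiff ℝ ∞ f) (hg : ContDiff ℝ ∞ g) (x : R3) :
    jac (fun y => f y + g y) x = jac f x + jac g x := by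
  ext i k
  simp only [jac]
  rw [fderiv_fun_add (hf.differentiable (by simp) x) (hg.differentiable (by simp) x)]
  rfl

theorem linearShear_periodic (L U : ℝ) : PeriodicXY L (linearShear L U) := by
  intro x
  constructor <;> simp [linearShear]

/-- Adding the linear shear to approximants that vanish near the walls gives smooth fields with the
exact wall values. They need not be divergence free. -/
theorem IsH1Shear.exists_smooth {L U : ℝ} {v : R3 → R3} {Dv : R3 → M3} (h : IsH1Shear L U v Dv) :
    ∃ f : ℕ → R3 → R3,
      (∀ n, ContDiff ℝ ∞ (f n) ∧ PeriodicXY L (f n) ∧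
        (∀ x : R3, (x 2 = 0 ∨ x 2 = L) → f n x = linearShear L U x)) ∧
      (∀ i, L2Conv (volume.restrict (box L)) (fun n x => f n x i) (fun x => v x i)) ∧
      (∀ i k, L2Conv (volume.restrict (box L)) (fun n x => jac (f n) x i k)
        (fun x => Dv x i k)) := by
  obtain ⟨hw, hDw, f, hf, t1, t2⟩ := h
  have hs := linearShear_contDiff L U
  have comp : ∀ {E : Fin 3 → Type} [∀ i, NormedAddCommGroup (E i)] (g : ℕ → R3 → ∀ i, E i)
      (i : Fin 3), Tendsto (fun n => eLpNorm (g n) 2 (volume.restrict (box L))) atTop (𝓝 0) →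
      Tendsto (fun n => eLpNorm (fun x => g n x i) 2 (volume.restrict (box L))) atTop (𝓝 0) := by
    intro E _ g i hg
    exact tendsto_of_tendsto_of_tendsto_of_le_of_le tendsto_const_nhds hg (fun _ => zero_le)
      fun n => eLpNorm_mono fun x => norm_le_pi_norm (g n x) i
  refine ⟨fun n x => f n x + linearShear L U x, ?_, ?_, ?_⟩
  · intro n
    refine ⟨(hf n).1.add hs, ?_, ?_⟩
    · intro x
      have h1 := (hf n).2.1 x
      have h2 := linearShear_periodic L U x
      simp only [h1.1, h1.2, h2.1, h2.2, and_self]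
    · intro x hx
      obtain ⟨a, b, ha, hb, hab⟩ := (hf n).2.2
      have : f n x = 0 := hab x (by rcases hx with hx | hx <;> rw [hx]
                                    · exact Or.inl ha.le
                                    · exact Or.inr hb.le)
      simp [this]
  · intro i
    have c0 : L2Conv (volume.restrict (box L)) (fun n x => f n x i)
        (fun x => v x i - linearShear L U x i) :=
      ⟨fun n => memLp_box_of_continuous ((continuous_apply i).comp (hf n).1.continuous),
        hw.eval i, comp (fun n x => f n x - (v x - linearShear L U x)) i t1⟩
    have := c0.add (L2Conv.const (memLp_box_of_continuous (L := L)
      ((continuous_apply i).comp hs.continuous)))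
    simpa using this
  · intro i k
    have c0 : L2Conv (volume.restrict (box L)) (fun n x => jac (f n) x i k)
        (fun x => Dv x i k - jac (linearShear L U) x i k) :=
      ⟨fun n => memLp_box_of_continuous (jac_continuous (hf n).1 i k),
        (hDw.eval i).eval k,
        comp (fun n x => (jac (f n) x - (Dv x - jac (linearShear L U) x)) i) k
          (comp (fun n x => jac (f n) x - (Dv x - jac (linearShear L U) x)) i t2)⟩
    have := c0.add (L2Conv.const (memLp_box_of_continuous (L := L) (jac_continuous hs i k)))
    simp only [jac_add (hf _).1 hs]
    simpa using this

/-! ### One dimensional inequalities -/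

/-- Cauchy–Schwarz against the constant 1, read off from the nonnegativity of the variance of `f`.
-/
theorem sq_integral_le {a b : ℝ} (hab : a ≤ b) {f : ℝ → ℝ} (hf : Continuous f) :
    (∫ z in a..b, f z) ^ 2 ≤ (b - a) * ∫ z in a..b, f z ^ 2 := by
  rcases hab.eq_or_lt with rfl | hlt
  · simp
  set I := ∫ z in a..b, f z with hI
  have h0 : 0 ≤ ∫ z in a..b, ((b - a) * f z - I) ^ 2 :=
    intervalIntegral.integral_nonneg hab fun z _ => sq_nonneg _
  have h1 : ∫ z in a..b, ((b - a) * f z - I) ^ 2 =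
      (b - a) ^ 2 * (∫ z in a..b, f z ^ 2) - 2 * (b - a) * I * I + (b - a) * I ^ 2 := by
    have e : ∀ z, ((b - a) * f z - I) ^ 2 =
        ((b - a) ^ 2 * f z ^ 2 - (2 * (b - a) * I) * f z) + I ^ 2 := fun z => by ring
    simp only [e]
    rw [intervalIntegral.integral_add, intervalIntegral.integral_sub,
      intervalIntegral.integral_const_mul, intervalIntegral.integral_const_mul,
      intervalIntegral.integral_const, smul_eq_mul]
    all_goals exact Continuous.intervalIntegrable (by fun_prop) _ _
  rw [h1] at h0
  have h2 : 0 ≤ (b - a) * ((b - a) * (∫ z in a..b, f z ^ 2) - I ^ 2) := by nlinarith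
  have := nonneg_of_mul_nonneg_right h2 (sub_pos.2 hlt)
  linarith

/-- Write h(z) as minus the integral of h' over [z, L] and apply Cauchy–Schwarz there. The factor L
- z, small at the moving wall, is what background slopes concentrated near it exploit. -/
theorem sq_le_of_vanish_right {L z : ℝ} (hz : z ∈ Set.Icc 0 L) {h h' : ℝ → ℝ}
    (hd : ∀ z, HasDerivAt h (h' z) z) (hc : Continuous h') (hL : h L = 0) :
    h z ^ 2 ≤ (L - z) * ∫ s in (0 : ℝ)..L, h' s ^ 2 := by
  have h1 : ∫ s in z..L, h' s = - h z := by
    rw [intervalIntegral.integral_eq_sub_of_hasDerivAt (fun s _ => hd s)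
      (hc.intervalIntegrable _ _), hL]; ring
  have h2 := sq_integral_le hz.2 hc
  rw [h1, neg_sq] at h2
  refine h2.trans (mul_le_mul_of_nonneg_left ?_ (sub_nonneg.2 hz.2))
  have hc2 : Continuous fun s => h' s ^ 2 := by fun_prop
  rw [← intervalIntegral.integral_add_adjacent_intervals (hc2.intervalIntegrable 0 z)
    (hc2.intervalIntegrable z L)]
  have := intervalIntegral.integral_nonneg (μ := volume) hz.1 (fun s _ => sq_nonneg (h' s))
  linarith

/-! ### Fubini on the box -/

/-- The point with horizontal coordinates `y` and height `z`. -/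
def point (y : Fin 2 → ℝ) (z : ℝ) : R3 := Fin.insertNth (2 : Fin 3) z y

theorem integrable_box_fubini {L : ℝ} {F : R3 → ℝ} (hF : IntegrableOn F (box L)) :
    Integrable (fun p : ℝ × (Fin 2 → ℝ) => F (point p.2 p.1))
      (((volume : Measure ℝ).restrict (Set.Ioo 0 L)).prod
        (Measure.pi fun _ => (volume : Measure ℝ).restrict (Set.Ioo 0 L))) ∧
    ∫ x in box L, F x = ∫ p, F (point p.2 p.1) ∂
      (((volume : Measure ℝ).restrict (Set.Ioo 0 L)).prod
        (Measure.pi fun _ => (volume : Measure ℝ).restrict (Set.Ioo 0 L))) := by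
  have mp := (measurePreserving_piFinSuccAbove
    (fun _ : Fin 3 => (volume : Measure ℝ).restrict (Set.Ioo 0 L)) 2).symm
  have he : ∀ p : ℝ × (Fin 2 → ℝ),
      (MeasurableEquiv.piFinSuccAbove (fun _ : Fin 3 => ℝ) 2).symm p = point p.2 p.1 :=
    fun p => rfl
  unfold IntegrableOn at hF
  rw [restrict_box] at hF ⊢
  constructor
  · have := (mp.integrable_comp_emb (MeasurableEquiv.measurableEmbedding _)).2 hF
    exact this
  · exact (mp.integral_comp (MeasurableEquiv.measurableEmbedding _) F).symm

theorem integral_box_fubini {L : ℝ} (hL : 0 ≤ L) {F : R3 → ℝ} (hF : IntegrableOn F (box L)) :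
    Integrable (fun y => ∫ z in (0 : ℝ)..L, F (point y z))
      (Measure.pi fun _ : Fin 2 => (volume : Measure ℝ).restrict (Set.Ioo 0 L)) ∧
    ∫ x in box L, F x = ∫ y, (∫ z in (0 : ℝ)..L, F (point y z)) ∂
        (Measure.pi fun _ : Fin 2 => (volume : Measure ℝ).restrict (Set.Ioo 0 L)) := by
  obtain ⟨h1, h2⟩ := integrable_box_fubini hF
  have e : ∀ y, ∫ z in (0 : ℝ)..L, F (point y z) = ∫ z in Set.Ioo 0 L, F (point y z) := fun y => by
    rw [intervalIntegral.integral_of_le hL, integral_Ioc_eq_integral_Ioo]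
  simp only [e]
  exact ⟨h1.integral_prod_right, by rw [h2, integral_prod_symm _ h1]⟩

theorem point_eq (y : Fin 2 → ℝ) (z : ℝ) : point y z = point y 0 + z • Pi.single 2 1 := by
  ext i
  fin_cases i <;> simp [point, Fin.insertNth, Fin.succAboveCases]

@[simp] theorem point_two (y : Fin 2 → ℝ) (z : ℝ) : point y z 2 = z := by
  simp [point]

theorem hasDerivAt_point {f : R3 → ℝ} (hf : Differentiable ℝ f) (y : Fin 2 → ℝ) (z : ℝ) :
    HasDerivAt (fun s => f (point y s)) (fderiv ℝ f (point y z) (Pi.single 2 1)) z := by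
  have h1 : HasDerivAt (fun s => point y s) (Pi.single 2 1) z := by
    have : (fun s => point y s) = fun s : ℝ => point y 0 + s • (Pi.single 2 1 : R3) :=
      funext fun s => point_eq y s
    rw [this]
    simpa using ((hasDerivAt_id z).smul_const (Pi.single 2 1 : R3)).const_add (point y 0)
  exact (hf (point y z)).hasFDerivAt.comp_hasDerivAt z h1

theorem continuous_point (y : Fin 2 → ℝ) : Continuous (point y) := by
  have : point y = fun s : ℝ => point y 0 + s • (Pi.single 2 1 : R3) :=
    funext fun s => point_eq y s
  rw [this]; fun_prop

theorem integrableOn_box_of_bdd {L : ℝ} {F : R3 → ℝ}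
    (hm : AEStronglyMeasurable F (volume.restrict (box L))) {C : ℝ}
    (hC : ∀ x ∈ box L, |F x| ≤ C) : IntegrableOn F (box L) :=
  Integrable.of_bound hm C ((ae_restrict_iff' (measurableSet_box L)).2 (ae_of_all _ hC))

/-- On each vertical line the pointwise bound of `sq_le_of_vanish_right` is multiplied by the weight
and integrated. The weight depends on the height only, so its integral factors out of the horizontal
integration. -/
theorem integral_weight_sq_le_of_contDiff {L : ℝ} (hL : 0 ≤ L) {f : R3 → ℝ} (hf : ContDiff ℝ ∞ f)
    (h0 : ∀ x : R3, x 2 = L → f x = 0) {ρ : ℝ → ℝ} (hρ : Measurable ρ) {C : ℝ}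
    (hρ0 : ∀ z, 0 ≤ ρ z) (hρC : ∀ z ∈ Set.Icc 0 L, ρ z ≤ C) :
    ∫ x in box L, ρ (x 2) * f x * f x ≤ (∫ z in (0 : ℝ)..L, ρ z * (L - z)) *
      ∫ x in box L, fderiv ℝ f x (Pi.single 2 1) * fderiv ℝ f x (Pi.single 2 1) := by
  have hd := hf.differentiable (by simp)
  have hc : Continuous fun x => fderiv ℝ f x (Pi.single 2 1) :=
    (hf.continuous_fderiv (by simp)).clm_apply continuous_const
  have hfc := hf.continuous
  have hρi : IntervalIntegrable ρ volume 0 L := by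
    rw [intervalIntegrable_iff_integrableOn_Icc_of_le hL]
    refine Measure.integrableOn_of_bounded (M := C) (by simp) hρ.aestronglyMeasurable ?_
    refine (ae_restrict_iff' measurableSet_Icc).2 (ae_of_all _ fun z hz => ?_)
    rw [Real.norm_of_nonneg (hρ0 z)]; exact hρC z hz
  have i1 : IntegrableOn (fun x => ρ (x 2) * f x * f x) (box L) := by
    obtain ⟨M, hM⟩ := exists_bound_box (L := L) hfc
    refine integrableOn_box_of_bdd (C := C * M * M) ?_ ?_
    · exact (((hρ.comp (measurable_pi_apply 2)).aestronglyMeasurable.mul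
        hfc.aestronglyMeasurable).mul hfc.aestronglyMeasurable)
    · intro x hx
      have hb := hρC (x 2) ⟨(hx 2).1.le, (hx 2).2.le⟩
      have hC0 := (hρ0 _).trans hb
      have hM0 := (abs_nonneg _).trans (hM x hx)
      rw [abs_mul, abs_mul, abs_of_nonneg (hρ0 _)]
      have := hM x hx
      gcongr
  have i2 : IntegrableOn (fun x => fderiv ℝ f x (Pi.single 2 1) * fderiv ℝ f x (Pi.single 2 1))
      (box L) := by
    obtain ⟨M, hM⟩ := exists_bound_box (L := L) (hc.mul hc)
    exact integrableOn_box_of_bdd (hc.mul hc).aestronglyMeasurable hM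
  obtain ⟨j1, e1⟩ := integral_box_fubini hL i1
  obtain ⟨j2, e2⟩ := integral_box_fubini hL i2
  rw [e1, e2, ← integral_const_mul]
  refine integral_mono j1 (j2.const_mul _) fun y => ?_
  beta_reduce
  set Q := ∫ z in (0 : ℝ)..L, fderiv ℝ f (point y z) (Pi.single 2 1) *
    fderiv ℝ f (point y z) (Pi.single 2 1) with hQ
  rw [← intervalIntegral.integral_mul_const]
  have hp := continuous_point y
  refine intervalIntegral.integral_mono_on hL ?_ ?_ ?_
  · simp only [point_two, mul_assoc]
    exact hρi.mul_continuousOn ((hfc.comp hp).mul (hfc.comp hp)).continuousOn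
  · exact (hρi.mul_continuousOn (by fun_prop)).mul_const _
  · intro z hz
    have key := sq_le_of_vanish_right hz (hasDerivAt_point hd y) (hc.comp hp)
      (h0 _ (point_two y L))
    simp only [point_two]
    have : (fun s => fderiv ℝ f (point y s) (Pi.single 2 1) ^ 2) =
      fun s => fderiv ℝ f (point y s) (Pi.single 2 1) *
        fderiv ℝ f (point y s) (Pi.single 2 1) := funext fun s => sq _
    simp only [this, ← hQ] at key
    calc ρ z * f (point y z) * f (point y z) = ρ z * f (point y z) ^ 2 := by ring
      _ ≤ ρ z * ((L - z) * Q) := mul_le_mul_of_nonneg_left key (hρ0 z)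
      _ = _ := by ring

theorem integral_deriv_box_of_contDiff {L : ℝ} (hL : 0 ≤ L) {f : R3 → ℝ} (hf : ContDiff ℝ ∞ f)
    {c₀ c₁ : ℝ} (h0 : ∀ x : R3, x 2 = 0 → f x = c₀) (h1 : ∀ x : R3, x 2 = L → f x = c₁) :
    ∫ x in box L, fderiv ℝ f x (Pi.single 2 1) = (c₁ - c₀) * L ^ 2 := by
  have hd := hf.differentiable (by simp)
  have hc : Continuous fun x => fderiv ℝ f x (Pi.single 2 1) :=
    (hf.continuous_fderiv (by simp)).clm_apply continuous_const
  have i2 : IntegrableOn (fun x => fderiv ℝ f x (Pi.single 2 1)) (box L) := by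
    obtain ⟨M, hM⟩ := exists_bound_box (L := L) hc
    exact integrableOn_box_of_bdd hc.aestronglyMeasurable hM
  rw [(integral_box_fubini hL i2).2]
  have : ∀ y, ∫ z in (0 : ℝ)..L, fderiv ℝ f (point y z) (Pi.single 2 1) = c₁ - c₀ := by
    intro y
    rw [intervalIntegral.integral_eq_sub_of_hasDerivAt (fun s _ => hasDerivAt_point hd y s)
      ((hc.comp (continuous_point y)).intervalIntegrable _ _), h0 _ (point_two y 0),
      h1 _ (point_two y L)]
  simp only [this]
  rw [integral_const, measureReal_def, Measure.pi_univ]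
  simp [hL, mul_comm]

/-! ### Shear profiles -/

/-- The slope of a profile: `g` above height `a`, zero below. -/
noncomputable def slope (a : ℝ) (g : ℝ → ℝ) (z : ℝ) : ℝ := if a < z then g z else 0

/-- The profile that vanishes below height `a` and has slope `g` above. -/
noncomputable def profile (a : ℝ) (g : ℝ → ℝ) (z : ℝ) : ℝ := if a < z then ∫ s in a..z, g s else 0

theorem slope_measurable {a : ℝ} {g : ℝ → ℝ} (hg : Continuous g) : Measurable (slope a g) :=
  Measurable.ite measurableSet_Ioi hg.measurable measurable_const

theorem profile_eq {a : ℝ} {g : ℝ → ℝ} (z : ℝ) : profile a g z = ∫ s in a..(max a z), g s := by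
  unfold profile
  split_ifs with h
  · rw [max_eq_right h.le]
  · rw [max_eq_left (not_lt.1 h), intervalIntegral.integral_same]

theorem profile_continuous {a : ℝ} {g : ℝ → ℝ} (hg : Continuous g) : Continuous (profile a g) := by
  have : profile a g = (fun z => ∫ s in a..z, g s) ∘ fun z => max a z :=
    funext fun z => profile_eq z
  rw [this]
  exact (intervalIntegral.continuous_primitive (fun _ _ => hg.intervalIntegrable _ _) a).comp
    (by fun_prop)

theorem exists_bound_slope {a L : ℝ} {g : ℝ → ℝ} (hg : Continuous g) :
    ∃ C, ∀ z ∈ Set.Icc 0 L, |slope a g z| ≤ C := by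
  obtain ⟨C, hC⟩ := (isCompact_Icc (a := (0 : ℝ)) (b := L)).exists_bound_of_continuousOn
    hg.continuousOn
  refine ⟨max C 0, fun z hz => ?_⟩
  unfold slope
  split_ifs
  · exact (hC z hz).trans (le_max_left _ _)
  · simp

theorem exists_bound_profile {a L : ℝ} {g : ℝ → ℝ} (hg : Continuous g) :
    ∃ C, ∀ z ∈ Set.Icc 0 L, |profile a g z| ≤ C :=
  (isCompact_Icc (a := (0 : ℝ)) (b := L)).exists_bound_of_continuousOn
    (profile_continuous hg).continuousOn

/-! ### Integration by parts in the convective term -/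

theorem hasFDerivAt_coord {f : R3 → R3} (hf : ContDiff ℝ ∞ f) (i : Fin 3) (x : R3) :
    HasFDerivAt (fun y => f y i) ((ContinuousLinearMap.proj i).comp (fderiv ℝ f x)) x :=
  (hasFDerivAt_pi'.1 (hf.differentiable (by simp) x).hasFDerivAt) i

theorem jac_eq {f : R3 → R3} (hf : ContDiff ℝ ∞ f) (i k : Fin 3) (x : R3) :
    jac f x i k = fderiv ℝ (fun y => f y i) x (Pi.single k 1) := by
  rw [(hasFDerivAt_coord hf i x).fderiv]; rfl

theorem contDiff_coord {f : R3 → R3} (hf : ContDiff ℝ ∞ f) (i : Fin 3) :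
    ContDiff ℝ ∞ fun y => f y i := contDiff_pi.1 hf i

theorem upper_box_ae_eq {L a : ℝ} (ha : 0 ≤ a) :
    (box L ∩ {x : R3 | a < x 2} : Set R3) =ᵐ[volume] Set.Icc ![0, 0, a] ![L, L, L] := by
  have : (box L ∩ {x : R3 | a < x 2} : Set R3) =
      Set.univ.pi fun i => Set.Ioo ((![0, 0, a] : R3) i) ((![L, L, L] : R3) i) := by
    ext x
    simp only [box, Set.mem_inter_iff, Set.mem_ofPred_eq, Set.mem_pi, Set.mem_univ, true_imp_iff,
      Set.mem_Ioo, Fin.forall_fin_succ, Fin.isValue]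
    simp
    constructor
    · rintro ⟨⟨h0, h1, h2⟩, h3⟩; exact ⟨h0, h1, h3, h2.2⟩
    · rintro ⟨h0, h1, h3, h2⟩; exact ⟨⟨h0, h1, ha.trans_lt h3, h2⟩, h3⟩
  rw [this]
  exact Measure.univ_pi_Ioo_ae_eq_Icc

/-- The divergence theorem: the fluxes through opposite lateral faces cancel by periodicity, and
those through the bottom and top faces vanish. -/
theorem integral_divergence_upper_box {L a : ℝ} (haL : a ≤ L) (hL : 0 ≤ L)
    (F : Fin 3 → R3 → ℝ) (F' : Fin 3 → R3 → R3 →L[ℝ] ℝ)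
    (hF : ∀ i x, HasFDerivAt (F i) (F' i x) x)
    (hc : Continuous fun x => ∑ i, F' i x (Pi.single i 1))
    (hper : ∀ x, F 0 (x + Pi.single 0 L) = F 0 x ∧ F 1 (x + Pi.single 1 L) = F 1 x)
    (hw : ∀ x : R3, (x 2 = a ∨ x 2 = L) → F 2 x = 0) :
    ∫ x in Set.Icc (![0, 0, a] : R3) ![L, L, L], ∑ i, F' i x (Pi.single i 1) = 0 := by
  have hle : (![0, 0, a] : R3) ≤ ![L, L, L] := by
    intro i; fin_cases i <;> simp [hL, haL]
  rw [integral_divergence_of_hasFDerivAt_off_countable' _ _ hle F F' ∅ Set.countable_empty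
    (fun i => (continuous_iff_continuousAt.2 fun x => (hF i x).continuousAt).continuousOn)
    (fun x _ i => hF i x) (hc.continuousOn.integrableOn_compact isCompact_Icc)]
  rw [Fin.sum_univ_three]
  have e0 : ∀ y : Fin 2 → ℝ, F 0 (Fin.insertNth (0 : Fin 3) L y : R3) =
      F 0 (Fin.insertNth (0 : Fin 3) 0 y : R3) := fun y => by
    rw [← (hper (Fin.insertNth (0 : Fin 3) 0 y : R3)).1]
    congr 1
    ext i; fin_cases i <;> simp [Fin.insertNth, Fin.succAboveCases]
    rfl
  have e1 : ∀ y : Fin 2 → ℝ, F 1 (Fin.insertNth (1 : Fin 3) L y : R3) =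
      F 1 (Fin.insertNth (1 : Fin 3) 0 y : R3) := fun y => by
    rw [← (hper (Fin.insertNth (1 : Fin 3) 0 y : R3)).2]
    congr 1
    ext i; fin_cases i <;> simp [Fin.insertNth, Fin.succAboveCases]
  have e2 : ∀ y : Fin 2 → ℝ, F 2 (Fin.insertNth (2 : Fin 3) L y : R3) = 0 := fun y =>
    hw _ (Or.inr (by simp))
  have e3 : ∀ y : Fin 2 → ℝ, F 2 (Fin.insertNth (2 : Fin 3) a y : R3) = 0 := fun y =>
    hw _ (Or.inl (by simp))
  have c0 : (![0, 0, a] : R3) 0 = 0 ∧ (![L, L, L] : R3) 0 = L ∧ (![0, 0, a] : R3) 1 = 0 ∧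
      (![L, L, L] : R3) 1 = L ∧ (![0, 0, a] : R3) 2 = a ∧ (![L, L, L] : R3) 2 = L := by simp
  simp only [c0, e0, e1, e2, e3, sub_self, integral_zero, add_zero]

/-- Above height a the integrand is the divergence of Φ(z)(v₀ - U)v, and below it is zero. The flux
vanishes at z = a because Φ(a) = 0 and at z = L because v₀ = U there. The sum containing the
divergence of `v` is kept, since the smooth approximants are not solenoidal. -/
theorem convect_profile_of_contDiff {L U a : ℝ} (ha : 0 ≤ a) (haL : a ≤ L)
    {g : ℝ → ℝ} (hg : Continuous g) {v : R3 → R3} (hv : ContDiff ℝ ∞ v) (hper : PeriodicXY L v)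
    (hw : ∀ x : R3, x 2 = L → v x 0 = U) :
    ∫ x in box L, ((∑ k, profile a g (x 2) * v x k * jac v x 0 k) +
      (∑ k, profile a g (x 2) * (v x 0 - U) * jac v x k k) +
      slope a g (x 2) * (v x 0 - U) * v x 2) = 0 := by
  -- The formula for the profile above `a`, extended differentiably across the kink; the two agree
  -- on the region that carries the integral.
  set q : ℝ → ℝ := fun z => ∫ s in a..z, g s with hq
  have hqd : ∀ z, HasDerivAt q (g z) z := fun z =>
    intervalIntegral.integral_hasDerivAt_right (hg.intervalIntegrable _ _)
      (hg.stronglyMeasurableAtFilter _ _) hg.continuousAt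
  have hqc : Continuous q := continuous_iff_continuousAt.2 fun z => (hqd z).continuousAt
  set D : R3 → ℝ := fun x => (∑ k, q (x 2) * v x k * jac v x 0 k) +
      (∑ k, q (x 2) * (v x 0 - U) * jac v x k k) + g (x 2) * (v x 0 - U) * v x 2 with hD
  have hvc : ∀ i, Continuous fun x => v x i := fun i => (contDiff_coord hv i).continuous
  have hjc := jac_continuous hv
  have hDc : Continuous D := by
    have h2 : Continuous fun x : R3 => q (x 2) := hqc.comp (continuous_apply 2)
    have h3 : Continuous fun x : R3 => g (x 2) := hg.comp (continuous_apply 2)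
    refine ((continuous_finsetSum _ fun k _ => ?_).add
      (continuous_finsetSum _ fun k _ => ?_)).add ?_
    · exact (h2.mul (hvc k)).mul (hjc 0 k)
    · exact (h2.mul ((hvc 0).sub continuous_const)).mul (hjc k k)
    · exact (h3.mul ((hvc 0).sub continuous_const)).mul (hvc 2)
  have hs : MeasurableSet {x : R3 | a < x 2} :=
    measurableSet_lt measurable_const (measurable_pi_apply 2)
  have e1 : ∀ x, ((∑ k, profile a g (x 2) * v x k * jac v x 0 k) +
      (∑ k, profile a g (x 2) * (v x 0 - U) * jac v x k k) +
      slope a g (x 2) * (v x 0 - U) * v x 2) = {x : R3 | a < x 2}.indicator D x := by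
    intro x
    by_cases hx : a < x 2
    · rw [Set.indicator_of_mem (by exact hx)]
      simp only [profile, slope, if_pos hx, hD, hq]
    · rw [Set.indicator_of_notMem (by exact hx)]
      simp only [profile, slope, if_neg hx]
      simp
  simp only [e1]
  rw [setIntegral_indicator hs, setIntegral_congr_set (upper_box_ae_eq ha)]
  have hF : ∀ (i : Fin 3) (x : R3), HasFDerivAt (fun y : R3 => v y i * ((v y 0 - U) * q (y 2)))
      (v x i • ((v x 0 - U) • (g (x 2) • ContinuousLinearMap.proj (R := ℝ) (φ := fun _ : Fin 3 => ℝ) 2)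
        + q (x 2) • (ContinuousLinearMap.proj 0).comp (fderiv ℝ v x))
        + ((v x 0 - U) * q (x 2)) • (ContinuousLinearMap.proj i).comp (fderiv ℝ v x)) x := by
    intro i x
    have h1 := hasFDerivAt_coord hv i x
    have h2 := (hasFDerivAt_coord hv 0 x).sub_const U
    have h3 : HasFDerivAt (fun y : R3 => q (y 2))
        (g (x 2) • ContinuousLinearMap.proj (R := ℝ) (φ := fun _ : Fin 3 => ℝ) 2) x :=
      (hqd (x 2)).comp_hasFDerivAt (f := fun y : R3 => y 2) x
        (ContinuousLinearMap.proj (R := ℝ) (φ := fun _ : Fin 3 => ℝ) 2).hasFDerivAt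
    exact h1.mul (h2.mul h3)
  have e2 : ∀ x, D x = ∑ i : Fin 3, (v x i • ((v x 0 - U) •
        (g (x 2) • ContinuousLinearMap.proj (R := ℝ) (φ := fun _ : Fin 3 => ℝ) 2)
        + q (x 2) • (ContinuousLinearMap.proj 0).comp (fderiv ℝ v x))
        + ((v x 0 - U) * q (x 2)) • (ContinuousLinearMap.proj i).comp (fderiv ℝ v x))
          (Pi.single i 1) := by
    intro x
    simp only [hD, jac, Fin.sum_univ_three]
    simp
    ring
  simp only [e2]
  refine integral_divergence_upper_box haL (ha.trans haL) _ _ hF ?_ ?_ ?_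
  · simp only [← e2]; exact hDc
  · intro x
    have := hper x
    simp [this.1, this.2]
  · rintro x (hx | hx)
    · simp [hx, hq]
    · simp [hw x hx]

/-! ### Estimates for fields with shear boundary values -/

/-- The velocity of the upper wall. -/
def wallVel (U : ℝ) : R3 := ![U, 0, 0]

/-- The field `(Φ(z), 0, 0)` for the profile `Φ` with slope `g` above height `a`. -/
noncomputable def shearField (a : ℝ) (g : ℝ → ℝ) (x : R3) : R3 := ![profile a g (x 2), 0, 0]

/-- The gradient of `shearField`. -/
noncomputable def shearGrad (a : ℝ) (g : ℝ → ℝ) (x : R3) : M3 :=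
  fun i k => if i = 0 ∧ k = 2 then slope a g (x 2) else 0

theorem linearShear_top {L U : ℝ} (hL : 0 < L) {x : R3} (hx : x 2 = L) :
    linearShear L U x = wallVel U := by
  ext i; fin_cases i <;> simp [linearShear, wallVel, hx, hL.ne']

theorem linearShear_bot {L U : ℝ} {x : R3} (hx : x 2 = 0) :
    linearShear L U x = 0 := by
  ext i; fin_cases i <;> simp [linearShear, hx]

theorem frob_shearGrad (A : M3) (a : ℝ) (g : ℝ → ℝ) (x : R3) :
    frob A (shearGrad a g x) = A 0 2 * slope a g (x 2) := by
  simp [frob, shearGrad, Fin.sum_univ_three]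

theorem sq_le_frob (A : M3) (i k : Fin 3) : A i k * A i k ≤ frob A A := by
  unfold frob
  refine le_trans ?_ (Finset.single_le_sum (f := fun i => ∑ k, A i k * A i k)
    (fun i _ => Finset.sum_nonneg fun k _ => mul_self_nonneg _) (Finset.mem_univ i))
  exact Finset.single_le_sum (f := fun k => A i k * A i k)
    (fun k _ => mul_self_nonneg _) (Finset.mem_univ k)

theorem frob_self_nonneg (A : M3) : 0 ≤ frob A A :=
  Finset.sum_nonneg fun _ _ => Finset.sum_nonneg fun _ _ => mul_self_nonneg _

theorem dot_self_nonneg (a : R3) : 0 ≤ dot a a :=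
  Finset.sum_nonneg fun _ _ => mul_self_nonneg _

namespace IsH1Shear

variable {L U : ℝ} {v : R3 → R3} {Dv : R3 → M3}

theorem memLp_coord (h : IsH1Shear L U v Dv) (i : Fin 3) :
    MemLp (fun x => v x i) 2 (volume.restrict (box L)) := by
  obtain ⟨f, -, h1, -⟩ := h.exists_smooth
  exact (h1 i).2.1

theorem memLp_grad (h : IsH1Shear L U v Dv) (i k : Fin 3) :
    MemLp (fun x => Dv x i k) 2 (volume.restrict (box L)) := by
  obtain ⟨f, -, -, h1⟩ := h.exists_smooth
  exact (h1 i k).2.1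

theorem integrableOn_frob (h : IsH1Shear L U v Dv) :
    IntegrableOn (fun x => frob (Dv x) (Dv x)) (box L) :=
  integrable_finsetSum _ fun i _ => integrable_finsetSum _ fun k _ =>
    (h.memLp_grad i k).integrable_mul (h.memLp_grad i k)

theorem memLp_sub_wallVel (h : IsH1Shear L U v Dv) (i : Fin 3) :
    MemLp (fun x => v x i - wallVel U i) 2 (volume.restrict (box L)) :=
  (h.memLp_coord i).sub (memLp_const _)

/-- The weighted Poincaré inequality holds for each component of the smooth approximants minus the
wall velocity, and both sides converge. Only vertical derivatives are needed; the others are added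
for convenience. -/
theorem integral_weight_dot_le (hL : 0 < L) (h : IsH1Shear L U v Dv) {ρ : ℝ → ℝ}
    (hρ : Measurable ρ) {C : ℝ} (hρ0 : ∀ z, 0 ≤ ρ z) (hρC : ∀ z ∈ Set.Icc 0 L, ρ z ≤ C) :
    IntegrableOn (fun x => ρ (x 2) * dot (fun i => v x i - wallVel U i)
      (fun i => v x i - wallVel U i)) (box L) ∧
    ∫ x in box L, ρ (x 2) * dot (fun i => v x i - wallVel U i) (fun i => v x i - wallVel U i) ≤
      (∫ z in (0 : ℝ)..L, ρ z * (L - z)) * ∫ x in box L, frob (Dv x) (Dv x) := by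
  obtain ⟨f, hf, c1, c2⟩ := h.exists_smooth
  have hρm : AEStronglyMeasurable (fun x : R3 => ρ (x 2)) (volume.restrict (box L)) :=
    (hρ.comp (measurable_pi_apply 2)).aestronglyMeasurable
  have hρb : ∀ᵐ x ∂(volume.restrict (box L)), |ρ (x 2)| ≤ C :=
    (ae_restrict_iff' (measurableSet_box L)).2 (ae_of_all _ fun x hx => by
      rw [abs_of_nonneg (hρ0 _)]; exact hρC _ ⟨(hx 2).1.le, (hx 2).2.le⟩)
  set K := ∫ z in (0 : ℝ)..L, ρ z * (L - z) with hK
  have hK0 : 0 ≤ K := intervalIntegral.integral_nonneg hL.le fun z hz =>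
    mul_nonneg (hρ0 z) (sub_nonneg.2 hz.2)
  have conv : ∀ i, L2Conv (volume.restrict (box L)) (fun n x => f n x i - wallVel U i)
      (fun x => v x i - wallVel U i) := fun i => by
    simpa [sub_eq_add_neg] using (c1 i).add (L2Conv.const (memLp_const (- wallVel U i)))
  have step : ∀ i, ∫ x in box L, ρ (x 2) * (v x i - wallVel U i) * (v x i - wallVel U i) ≤
      K * ∫ x in box L, Dv x i 2 * Dv x i 2 := by
    intro i
    refine le_of_tendsto_of_tendsto' ((conv i).integral_bdd_mul_mul (conv i) hρm hρb)
      (((c2 i 2).integral_mul (c2 i 2)).const_mul K) fun n => ?_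
    have hc : ContDiff ℝ ∞ fun x => f n x i - wallVel U i :=
      (contDiff_coord (hf n).1 i).sub contDiff_const
    have := integral_weight_sq_le_of_contDiff hL.le hc (fun x hx => by
      rw [(hf n).2.2 x (Or.inr hx), linearShear_top hL hx, sub_self]) hρ hρ0 hρC
    simpa only [jac_eq (hf n).1, fderiv_sub_const] using this
  have int1 : ∀ i, IntegrableOn (fun x => ρ (x 2) * (v x i - wallVel U i) *
      (v x i - wallVel U i)) (box L) := fun i =>
    (((conv i).bdd_mul hρm hρb).2.1).integrable_mul (conv i).2.1
  have e1 : ∀ x, ρ (x 2) * dot (fun i => v x i - wallVel U i) (fun i => v x i - wallVel U i) =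
      ∑ i, ρ (x 2) * (v x i - wallVel U i) * (v x i - wallVel U i) := fun x => by
    simp only [dot, Finset.mul_sum, mul_assoc]
  simp only [e1]
  refine ⟨integrable_finsetSum _ fun i _ => int1 i, ?_⟩
  rw [integral_finsetSum _ fun i _ => int1 i]
  refine (Finset.sum_le_sum fun i _ => step i).trans ?_
  have int2 : ∀ i, IntegrableOn (fun x => Dv x i 2 * Dv x i 2) (box L) := fun i =>
    (h.memLp_grad i 2).integrable_mul (h.memLp_grad i 2)
  rw [← Finset.mul_sum, ← integral_finsetSum _ fun i _ => int2 i]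
  refine mul_le_mul_of_nonneg_left (integral_mono ?_ h.integrableOn_frob fun x => ?_) hK0
  · exact integrable_finsetSum _ fun i _ => int2 i
  · exact Finset.sum_le_sum fun i _ => Finset.single_le_sum (f := fun k => Dv x i k * Dv x i k)
      (fun k _ => mul_self_nonneg _) (Finset.mem_univ 2)

/-- The boundary values fix the mean of ∂_z v₀ as U/L, so no admissible field has less gradient
energy than the linear shear. This keeps the denominator of the effective viscosity positive. -/
theorem le_integral_frob (hL : 0 < L) (h : IsH1Shear L U v Dv) :
    U ^ 2 * L ≤ ∫ x in box L, frob (Dv x) (Dv x) := by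
  obtain ⟨f, hf, c1, c2⟩ := h.exists_smooth
  have h1 : ∫ x in box L, Dv x 0 2 = U * L ^ 2 := by
    have t := (c2 0 2).integral_mul (L2Conv.const (memLp_const (1 : ℝ)))
    simp only [mul_one] at t
    refine tendsto_nhds_unique t (tendsto_const_nhds.congr fun n => ?_)
    simp only [jac_eq (hf n).1]
    rw [integral_deriv_box_of_contDiff hL.le (contDiff_coord (hf n).1 0) (c₀ := 0) (c₁ := U),
      sub_zero]
    · intro x hx; rw [(hf n).2.2 x (Or.inl hx), linearShear_bot hx]; rfl
    · intro x hx; rw [(hf n).2.2 x (Or.inr hx), linearShear_top hL hx]; rfl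
  have i1 : IntegrableOn (fun x => Dv x 0 2) (box L) :=
    (h.memLp_grad 0 2).integrable (by norm_num)
  -- The tangent line inequality s² ≥ 2ms - m² at the mean slope m = U/L replaces Cauchy–Schwarz.
  have h2 : ∫ x in box L, (2 * (U / L) * Dv x 0 2 - (U / L) ^ 2) ≤
      ∫ x in box L, frob (Dv x) (Dv x) := by
    refine integral_mono ((i1.const_mul _).sub (integrable_const _)) h.integrableOn_frob
      fun x => ?_
    refine le_trans ?_ (sq_le_frob (Dv x) 0 2)
    nlinarith [sq_nonneg (Dv x 0 2 - U / L)]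
  rw [integral_sub (i1.const_mul _) (integrable_const _), integral_const_mul, h1,
    integral_const, measureReal_restrict_apply_univ, volume_real_box hL.le, smul_eq_mul] at h2
  refine le_trans (le_of_eq ?_) h2
  field_simp
  ring

theorem integrableOn_convect (h : IsH1Shear L U v Dv) {a : ℝ} {g : ℝ → ℝ} (hg : Continuous g) :
    IntegrableOn (fun x => dot (convect (v x) (Dv x)) (shearField a g x)) (box L) := by
  obtain ⟨C, hC⟩ := exists_bound_profile (a := a) (L := L) hg
  have e : ∀ x, dot (convect (v x) (Dv x)) (shearField a g x) =
      profile a g (x 2) * ∑ k, v x k * Dv x 0 k := fun x => by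
    simp [dot, convect, shearField, Fin.sum_univ_three, mul_comm]
  simp only [e]
  refine Integrable.bdd_mul (c := C) (integrable_finsetSum _ fun k _ =>
    (h.memLp_coord k).integrable_mul (h.memLp_grad 0 k)) ?_ ?_
  · exact ((profile_continuous hg).comp (continuous_apply 2)).aestronglyMeasurable
  · exact (ae_restrict_iff' (measurableSet_box L)).2 (ae_of_all _ fun x hx =>
      hC _ ⟨(hx 2).1.le, (hx 2).2.le⟩)

/-- The limit of `convect_profile_of_contDiff` along smooth approximants. The divergence term is
carried through the limit and dropped only for `v` itself. -/
theorem integral_convect (hL : 0 < L) (h : IsH1Shear L U v Dv) (hdiv : DivFree L Dv)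
    {a : ℝ} (ha : 0 ≤ a) (haL : a ≤ L) {g : ℝ → ℝ} (hg : Continuous g) :
    ∫ x in box L, dot (convect (v x) (Dv x)) (shearField a g x) =
      - ∫ x in box L, slope a g (x 2) * (v x 0 - U) * v x 2 := by
  obtain ⟨f, hf, c1, c2⟩ := h.exists_smooth
  set μ := (volume : Measure R3).restrict (box L) with hμ
  have cv : L2Conv μ (fun n x => f n x 0 - U) (fun x => v x 0 - U) := by
    simpa [sub_eq_add_neg] using (c1 0).add (L2Conv.const (memLp_const (- U)))
  have pm : AEStronglyMeasurable (fun x : R3 => profile a g (x 2)) μ :=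
    ((profile_continuous hg).comp (continuous_apply 2)).aestronglyMeasurable
  obtain ⟨C, hC⟩ := exists_bound_profile (a := a) (L := L) hg
  have pb : ∀ᵐ x ∂μ, |profile a g (x 2)| ≤ C :=
    (ae_restrict_iff' (measurableSet_box L)).2 (ae_of_all _ fun x hx =>
      hC _ ⟨(hx 2).1.le, (hx 2).2.le⟩)
  have sm : AEStronglyMeasurable (fun x : R3 => slope a g (x 2)) μ :=
    ((slope_measurable hg).comp (measurable_pi_apply 2)).aestronglyMeasurable
  obtain ⟨C', hC'⟩ := exists_bound_slope (a := a) (L := L) hg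
  have sb : ∀ᵐ x ∂μ, |slope a g (x 2)| ≤ C' :=
    (ae_restrict_iff' (measurableSet_box L)).2 (ae_of_all _ fun x hx =>
      hC' _ ⟨(hx 2).1.le, (hx 2).2.le⟩)
  have split : ∀ (w : R3 → R3) (Dw : R3 → M3), (∀ i, MemLp (fun x => w x i) 2 μ) →
      MemLp (fun x => w x 0 - U) 2 μ → (∀ i k, MemLp (fun x => Dw x i k) 2 μ) →
      ∫ x, ((∑ k, profile a g (x 2) * w x k * Dw x 0 k) +
        (∑ k, profile a g (x 2) * (w x 0 - U) * Dw x k k) +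
        slope a g (x 2) * (w x 0 - U) * w x 2) ∂μ =
      (∑ k, ∫ x, profile a g (x 2) * w x k * Dw x 0 k ∂μ) +
        (∑ k, ∫ x, profile a g (x 2) * (w x 0 - U) * Dw x k k ∂μ) +
        ∫ x, slope a g (x 2) * (w x 0 - U) * w x 2 ∂μ := by
    intro w Dw hw hw0 hDw
    have j1 : ∀ k, Integrable (fun x => profile a g (x 2) * w x k * Dw x 0 k) μ := fun k =>
      (((L2Conv.const (hw k)).bdd_mul pm pb).2.1).integrable_mul (hDw 0 k)
    have j2 : ∀ k, Integrable (fun x => profile a g (x 2) * (w x 0 - U) * Dw x k k) μ := fun k =>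
      (((L2Conv.const hw0).bdd_mul pm pb).2.1).integrable_mul (hDw k k)
    have j3 : Integrable (fun x => slope a g (x 2) * (w x 0 - U) * w x 2) μ :=
      (((L2Conv.const hw0).bdd_mul sm sb).2.1).integrable_mul (hw 2)
    have s1 := integrable_finsetSum (μ := μ) Finset.univ fun k _ => j1 k
    have s2 := integrable_finsetSum (μ := μ) Finset.univ fun k _ => j2 k
    have s12 : Integrable (fun x => (∑ k, profile a g (x 2) * w x k * Dw x 0 k) +
        (∑ k, profile a g (x 2) * (w x 0 - U) * Dw x k k)) μ := s1.add s2
    rw [integral_add s12 j3, integral_add s1 s2,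
      integral_finsetSum _ fun k _ => j1 k, integral_finsetSum _ fun k _ => j2 k]
  have lim := ((tendsto_finsetSum Finset.univ fun k _ =>
      (c1 k).integral_bdd_mul_mul (c2 0 k) pm pb).add
    (tendsto_finsetSum Finset.univ fun k _ =>
      cv.integral_bdd_mul_mul (c2 k k) pm pb)).add (cv.integral_bdd_mul_mul (c1 2) sm sb)
  have zero : ∀ n, (∑ k, ∫ x, profile a g (x 2) * f n x k * jac (f n) x 0 k ∂μ) +
        (∑ k, ∫ x, profile a g (x 2) * (f n x 0 - U) * jac (f n) x k k ∂μ) +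
        ∫ x, slope a g (x 2) * (f n x 0 - U) * f n x 2 ∂μ = 0 := fun n => by
    rw [← split (f n) (jac (f n)) (fun i => (c1 i).1 n) (cv.1 n) (fun i k => (c2 i k).1 n)]
    exact convect_profile_of_contDiff ha haL hg (hf n).1 (hf n).2.1 fun x hx => by
      rw [(hf n).2.2 x (Or.inr hx), linearShear_top hL hx]; rfl
  have key := tendsto_nhds_unique lim (tendsto_const_nhds.congr fun n => (zero n).symm)
  rw [← split v Dv (fun i => (c1 i).2.1) cv.2.1 (fun i k => (c2 i k).2.1)] at key
  have i1 := h.integrableOn_convect (a := a) hg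
  have i3 : Integrable (fun x => slope a g (x 2) * (v x 0 - U) * v x 2) μ :=
    ((cv.bdd_mul sm sb).2.1).integrable_mul (c1 2).2.1
  have e : ∫ x, ((∑ k, profile a g (x 2) * v x k * Dv x 0 k) +
        (∑ k, profile a g (x 2) * (v x 0 - U) * Dv x k k) +
        slope a g (x 2) * (v x 0 - U) * v x 2) ∂μ =
      ∫ x, (dot (convect (v x) (Dv x)) (shearField a g x) +
        slope a g (x 2) * (v x 0 - U) * v x 2) ∂μ := by
    refine integral_congr_ae ?_
    filter_upwards [hdiv] with x hx
    rw [← Finset.mul_sum, hx]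
    simp [dot, convect, shearField, Fin.sum_univ_three]
    ring
  rw [e, integral_add i1 i3] at key
  linarith

/-- The wall velocity has no vertical component, so -(v₀ - U)v₂ is a product of two components of v
minus the wall velocity, hence at most half its squared length. The weighted Poincaré inequality
with the slope as weight finishes. -/
theorem integral_convect_le (hL : 0 < L) (h : IsH1Shear L U v Dv) (hdiv : DivFree L Dv)
    {a : ℝ} (ha : 0 ≤ a) (haL : a ≤ L) {g : ℝ → ℝ} (hg : Continuous g) (hg0 : ∀ z, 0 ≤ g z) :
    ∫ x in box L, dot (convect (v x) (Dv x)) (shearField a g x) ≤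
      (1 / 2) * (∫ z in (0 : ℝ)..L, slope a g z * (L - z)) * ∫ x in box L, frob (Dv x) (Dv x) := by
  obtain ⟨C, hC⟩ := exists_bound_slope (a := a) (L := L) hg
  have s0 : ∀ z, 0 ≤ slope a g z := fun z => by unfold slope; split_ifs; exacts [hg0 z, le_rfl]
  obtain ⟨i1, h1⟩ := h.integral_weight_dot_le hL (slope_measurable (a := a) hg) s0
    (fun z hz => (le_abs_self _).trans (hC z hz))
  rw [h.integral_convect hL hdiv ha haL hg, ← integral_neg, mul_assoc]
  refine le_trans ?_ (mul_le_mul_of_nonneg_left h1 (by norm_num : (0 : ℝ) ≤ 1 / 2))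
  rw [← integral_const_mul]
  have i2 : IntegrableOn (fun x => slope a g (x 2) * (v x 0 - U) * v x 2) (box L) :=
    (((L2Conv.const (h.memLp_sub_wallVel 0)).bdd_mul
      ((slope_measurable hg).comp (measurable_pi_apply 2)).aestronglyMeasurable
      ((ae_restrict_iff' (measurableSet_box L)).2 (ae_of_all _ fun x hx =>
      hC _ ⟨(hx 2).1.le, (hx 2).2.le⟩))).2.1).integrable_mul (h.memLp_coord 2)
  refine integral_mono i2.neg (i1.const_mul _) fun x => ?_
  have := s0 (x 2)
  simp only [dot, Fin.sum_univ_three, wallVel, Matrix.cons_val_zero, Matrix.cons_val_one,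
    Matrix.cons_val, sub_zero]
  nlinarith [mul_nonneg this (sq_nonneg (v x 0 - U + v x 2)), mul_nonneg this (sq_nonneg (v x 1))]

end IsH1Shear

/-! ### Approximation of profiles -/

/-- Approximate `G` by a smooth function and cut off near the endpoints. The cutoff error is small
because `G` is bounded and the two end strips are short. -/
theorem exists_smooth_compact_approx {L : ℝ} (hL : 0 < L) {G : ℝ → ℝ} (hG : Measurable G) {B : ℝ}
    (hB : ∀ z ∈ Set.Ioo 0 L, |G z| ≤ B) {ε : ℝ} (hε : 0 < ε) :
    ∃ k : ℝ → ℝ, ContDiff ℝ ∞ k ∧ (∃ α β, 0 < α ∧ β < L ∧ ∀ z, (z ≤ α ∨ β ≤ z) → k z = 0) ∧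
      eLpNorm (fun z => k z - G z) 2 (volume.restrict (Set.Ioo 0 L)) ≤ ENNReal.ofReal ε := by
  set μ := (volume : Measure ℝ).restrict (Set.Ioo 0 L) with hμ
  have hGm : MemLp G 2 μ := MemLp.of_bound hG.aestronglyMeasurable B
    ((ae_restrict_iff' measurableSet_Ioo).2 (ae_of_all _ hB))
  obtain ⟨g, -, hg, hgε⟩ := hGm.exist_eLpNorm_sub_le (by norm_num) (by norm_num)
    (half_pos hε)
  have hB0 : 0 ≤ B := (abs_nonneg _).trans (hB (L / 2) ⟨by linarith, by linarith⟩)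
  obtain ⟨η, hη, hηL, hηε⟩ : ∃ η > 0, 4 * η < L / 2 ∧ B * √(4 * η) ≤ ε / 2 := by
    have t : Tendsto (fun η : ℝ => B * √(4 * η)) (𝓝[>] 0) (𝓝 0) := by
      have : Continuous fun η : ℝ => B * √(4 * η) := by fun_prop
      simpa using (this.tendsto 0).mono_left nhdsWithin_le_nhds
    have h1 := t.eventually (ge_mem_nhds (half_pos hε))
    have h2 : ∀ᶠ η : ℝ in 𝓝[>] 0, 4 * η < L / 2 := by
      filter_upwards [Ioo_mem_nhdsGT (show (0 : ℝ) < L / 8 by positivity)] with η h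
      linarith [h.2]
    obtain ⟨η, h⟩ := (h1.and (h2.and self_mem_nhdsWithin)).exists
    exact ⟨η, h.2.2, h.2.1, h.1⟩
  -- Equal to 1 on [2η, L - 2η] and to 0 outside (η, L - η), so the cutoff acts on total length at
  -- most 4η.
  let χ : ContDiffBump (L / 2) := ⟨L / 2 - 2 * η, L / 2 - η, by linarith, by linarith⟩
  refine ⟨fun z => χ z * g z, χ.contDiff.mul hg, ⟨η, L - η, hη, by linarith, ?_⟩, ?_⟩
  · intro z hz
    have : χ z = 0 := χ.zero_of_le_dist (by
      change L / 2 - η ≤ dist z (L / 2)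
      rw [Real.dist_eq]
      rcases hz with hz | hz
      · rw [abs_of_nonpos (by linarith)]; linarith
      · rw [abs_of_nonneg (by linarith)]; linarith)
    simp [this]
  · have e : (fun z => χ z * g z - G z) =
        (fun z => χ z * (g z - G z)) + fun z => (χ z - 1) * G z := by
      ext z; simp only [Pi.add_apply]; ring
    have hχm := χ.continuous.aestronglyMeasurable (μ := μ)
    have hgm := hg.continuous.aestronglyMeasurable (μ := μ)
    rw [e, show ε = ε / 2 + ε / 2 by ring, ENNReal.ofReal_add (by positivity) (by positivity)]
    refine (eLpNorm_add_le (hχm.mul (hgm.sub hGm.1))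
      ((hχm.sub aestronglyMeasurable_const).mul hGm.1) (by norm_num)).trans (add_le_add ?_ ?_)
    · refine le_trans (eLpNorm_mono fun z => ?_) hgε
      rw [Pi.mul_apply, norm_mul, Pi.sub_apply, Pi.sub_apply, norm_sub_rev (g z), Real.norm_of_nonneg χ.nonneg]
      exact mul_le_of_le_one_left (norm_nonneg _) χ.le_one
    · set S : Set ℝ := Set.Icc 0 (2 * η) ∪ Set.Icc (L - 2 * η) L with hS
      have hSm : MeasurableSet S := measurableSet_Icc.union measurableSet_Icc
      have h1 : eLpNorm (fun z => (χ z - 1) * G z) 2 μ ≤ eLpNorm (S.indicator fun _ => B) 2 μ := by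
        refine eLpNorm_mono_ae ((ae_restrict_iff' measurableSet_Ioo).2 (ae_of_all _ fun z hz => ?_))
        by_cases hzS : z ∈ S
        · rw [Set.indicator_of_mem hzS, norm_mul, Real.norm_of_nonneg hB0]
          have : |χ z - 1| ≤ 1 := by
            rw [abs_le]; constructor <;> linarith [χ.nonneg (x := z), χ.le_one (x := z)]
          calc |χ z - 1| * |G z| ≤ 1 * B :=
                mul_le_mul this (hB z hz) (abs_nonneg _) zero_le_one
            _ = B := one_mul B
        · have : χ z = 1 := χ.one_of_mem_closedBall (by
            change dist z (L / 2) ≤ L / 2 - 2 * η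
            rw [Real.dist_eq, abs_le]
            simp only [hS, Set.mem_union, Set.mem_Icc, not_or, not_and_or, not_le] at hzS
            have := hz.1; have := hz.2
            constructor
            · rcases hzS.1 with h | h <;> linarith
            · rcases hzS.2 with h | h <;> linarith)
          simp [this]
      refine h1.trans ?_
      rw [eLpNorm_indicator_const hSm (by norm_num) (by norm_num)]
      have h2 : μ S ≤ ENNReal.ofReal (4 * η) := by
        refine (Measure.restrict_apply_le _ _).trans ((measure_union_le _ _).trans ?_)
        rw [Real.volume_Icc, Real.volume_Icc, ← ENNReal.ofReal_add (by linarith) (by linarith)]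
        exact ENNReal.ofReal_le_ofReal (by linarith)
      calc ‖B‖ₑ * μ S ^ (1 / (2 : ENNReal).toReal)
          ≤ ENNReal.ofReal B * ENNReal.ofReal (√(4 * η)) := by
            rw [Real.enorm_of_nonneg hB0]
            gcongr
            refine (ENNReal.rpow_le_rpow h2 (by norm_num)).trans (le_of_eq ?_)
            rw [ENNReal.ofReal_rpow_of_nonneg (by positivity) (by norm_num), Real.sqrt_eq_rpow]
            norm_num
        _ = ENNReal.ofReal (B * √(4 * η)) := (ENNReal.ofReal_mul hB0).symm
        _ ≤ _ := ENNReal.ofReal_le_ofReal hηε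

/-- The approximants of `G` are corrected to have mean zero exactly. Since they vanish near both
ends, so do their primitives, as needed for fields vanishing near both walls. -/
theorem exists_smooth_primitive_approx {L : ℝ} (hL : 0 < L) {G : ℝ → ℝ} (hG : Measurable G) {B : ℝ}
    (hB : ∀ z ∈ Set.Ioo 0 L, |G z| ≤ B) (h0 : ∫ z in (0 : ℝ)..L, G z = 0) :
    ∃ h h' : ℕ → ℝ → ℝ, (∀ n, ContDiff ℝ ∞ (h n)) ∧ (∀ n, ContDiff ℝ ∞ (h' n)) ∧
      (∀ n z, HasDerivAt (h n) (h' n z) z) ∧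
      (∀ n, ∃ α β, 0 < α ∧ β < L ∧ ∀ z, (z ≤ α ∨ β ≤ z) → h n z = 0) ∧
      Tendsto (fun n => eLpNorm (fun z => h n z - ∫ s in (0 : ℝ)..z, G s) 2
        (volume.restrict (Set.Ioo 0 L))) atTop (𝓝 0) ∧
      Tendsto (fun n => eLpNorm (fun z => h' n z - G z) 2
        (volume.restrict (Set.Ioo 0 L))) atTop (𝓝 0) := by
  set μ := (volume : Measure ℝ).restrict (Set.Ioo 0 L) with hμ
  have hGm : MemLp G 2 μ := MemLp.of_bound hG.aestronglyMeasurable B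
    ((ae_restrict_iff' measurableSet_Ioo).2 (ae_of_all _ hB))
  have toIoo : ∀ F : ℝ → ℝ, ∫ z, F z ∂μ = ∫ z in (0 : ℝ)..L, F z := fun F => by
    rw [intervalIntegral.integral_of_le hL.le, integral_Ioc_eq_integral_Ioo]
  choose k hk hk0 hkε using fun n : ℕ =>
    exists_smooth_compact_approx hL hG hB (ε := 1 / ((n : ℝ) + 1)) (by positivity)
  have memC : ∀ f : ℝ → ℝ, Continuous f → MemLp f 2 μ := fun f hf => by
    obtain ⟨C, hC⟩ := (isCompact_Icc (a := (0 : ℝ)) (b := L)).exists_bound_of_continuousOn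
      hf.continuousOn
    exact MemLp.of_bound hf.aestronglyMeasurable C
      ((ae_restrict_iff' measurableSet_Ioo).2 (ae_of_all _ fun z hz => hC z ⟨hz.1.le, hz.2.le⟩))
  have ck : L2Conv μ k G := by
    refine ⟨fun n => memC _ (hk n).continuous, hGm, ?_⟩
    have t : Tendsto (fun n : ℕ => ENNReal.ofReal (1 / ((n : ℝ) + 1))) atTop (𝓝 0) := by
      simpa using ENNReal.tendsto_ofReal tendsto_one_div_add_atTop_nhds_zero_nat
    exact tendsto_of_tendsto_of_tendsto_of_le_of_le tendsto_const_nhds t (fun _ => zero_le) hkε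
  let χ : ContDiffBump (L / 2) := ⟨L / 8, L / 4, by linarith, by linarith⟩
  have hχ0 : ∀ z, (z ≤ L / 4 ∨ 3 * L / 4 ≤ z) → χ z = 0 := fun z hz => χ.zero_of_le_dist (by
      change L / 4 ≤ dist z (L / 2)
      rw [Real.dist_eq]
      rcases hz with hz | hz
      · rw [abs_of_nonpos (by linarith)]; linarith
      · rw [abs_of_nonneg (by linarith)]; linarith)
  set m := ∫ z in (0 : ℝ)..L, χ z with hm
  have hmpos : 0 < m := by
    refine intervalIntegral.integral_pos hL χ.continuous.continuousOn (fun _ _ => χ.nonneg)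
      ⟨L / 2, ⟨by linarith, by linarith⟩, χ.pos_of_mem_ball ?_⟩
    simp [χ, hL]
  set c : ℕ → ℝ := fun n => ∫ z in (0 : ℝ)..L, k n z with hc
  have tc : Tendsto c atTop (𝓝 0) := by
    have := ck.integral_mul (L2Conv.const (memLp_const (1 : ℝ)))
    simpa only [mul_one, toIoo, h0] using this
  -- A multiple of one fixed bump removes the mean `c n`. The correction tends to zero in L² because
  -- `c n` tends to the integral of `G`, which is 0.
  set h' : ℕ → ℝ → ℝ := fun n z => k n z + (-(c n / m)) * χ z with hh'
  have ch' : L2Conv μ h' G := by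
    have c2 : L2Conv μ (fun n z => (-(c n / m)) * χ z) (fun _ => 0) := by
      refine ⟨fun n => memC _ (continuous_const.mul χ.continuous), memLp_const 0, ?_⟩
      have e : ∀ n, eLpNorm (fun z => (-(c n / m)) * χ z - 0) 2 μ =
          ‖-(c n / m)‖ₑ * eLpNorm χ 2 μ := fun n => by
        simp only [sub_zero]
        exact eLpNorm_const_smul (-(c n / m)) χ 2 μ
      simp only [e]
      have t : Tendsto (fun n => ‖-(c n / m)‖ₑ) atTop (𝓝 0) := by
        have := ((tc.div_const m).neg).enorm
        simpa using this
      simpa using ENNReal.Tendsto.mul_const t (Or.inr (memC χ χ.continuous).2.ne)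
    simpa only [add_zero] using ck.add c2
  have sm' : ∀ n, ContDiff ℝ ∞ (h' n) := fun n => (hk n).add (contDiff_const.mul χ.contDiff)
  have hI : ∀ n, ∫ z in (0 : ℝ)..L, h' n z = 0 := fun n => by
    have i1 := (hk n).continuous.intervalIntegrable (μ := volume) 0 L
    have i2 := χ.continuous.intervalIntegrable (μ := volume) 0 L
    simp only [hh']
    rw [intervalIntegral.integral_add i1 (i2.const_mul _), intervalIntegral.integral_const_mul]
    change c n + -(c n / m) * m = 0
    field_simp
    ring
  have hd : ∀ n z, HasDerivAt (fun z => ∫ s in (0 : ℝ)..z, h' n s) (h' n z) z := fun n z =>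
    intervalIntegral.integral_hasDerivAt_right ((sm' n).continuous.intervalIntegrable _ _)
      ((sm' n).continuous.stronglyMeasurableAtFilter _ _) (sm' n).continuous.continuousAt
  refine ⟨fun n z => ∫ s in (0 : ℝ)..z, h' n s, h', ?_, sm', hd, ?_, ?_, ch'.2.2⟩
  · intro n
    rw [contDiff_infty_iff_deriv]
    refine ⟨fun z => (hd n z).differentiableAt, ?_⟩
    rw [show deriv (fun z => ∫ s in (0 : ℝ)..z, h' n s) = h' n from funext fun z => (hd n z).deriv]
    exact sm' n
  · intro n
    obtain ⟨α, β, hα, hβ, hαβ⟩ := hk0 n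
    refine ⟨min α (L / 4), max β (3 * L / 4), by positivity, max_lt hβ (by linarith), ?_⟩
    have z1 : ∀ s, s ≤ min α (L / 4) → h' n s = 0 := fun s hs => by
      simp only [hh', hαβ s (Or.inl (hs.trans (min_le_left _ _))),
        hχ0 s (Or.inl (hs.trans (min_le_right _ _)))]; simp
    have z2 : ∀ s, max β (3 * L / 4) ≤ s → h' n s = 0 := fun s hs => by
      simp only [hh', hαβ s (Or.inr ((le_max_left _ _).trans hs)),
        hχ0 s (Or.inr ((le_max_right _ _).trans hs))]; simp
    rintro z (hz | hz)
    · beta_reduce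
      rw [intervalIntegral.integral_congr (g := fun _ => 0), intervalIntegral.integral_zero]
      intro s hs
      refine z1 s ?_
      rcases Set.mem_uIcc.1 hs with h | h
      · exact h.2.trans hz
      · exact h.2.trans (by positivity)
    · beta_reduce
      rw [← intervalIntegral.integral_add_adjacent_intervals
        ((sm' n).continuous.intervalIntegrable 0 L) ((sm' n).continuous.intervalIntegrable L z),
        hI, zero_add, intervalIntegral.integral_congr (g := fun _ => 0),
        intervalIntegral.integral_zero]
      intro s hs
      refine z2 s ?_
      have hmL : max β (3 * L / 4) ≤ L := (max_lt hβ (by linarith)).le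
      rcases Set.mem_uIcc.1 hs with h | h
      · exact hmL.trans h.1
      · exact hz.trans h.1
  -- The primitives converge uniformly: their distance at every height is at most the L¹ distance of
  -- the slopes.
  · have cabs : L2Conv μ (fun n z => |h' n z - G z|) (fun _ => 0) := by
      refine ⟨fun n => ((ch'.1 n).sub hGm).abs, memLp_const 0, ?_⟩
      refine ch'.2.2.congr fun n => ?_
      simp only [sub_zero]
      exact (eLpNorm_norm (fun z => h' n z - G z)).symm
    have td : Tendsto (fun n => ∫ z in (0 : ℝ)..L, |h' n z - G z|) atTop (𝓝 0) := by
      have := cabs.integral_mul (L2Conv.const (memLp_const (1 : ℝ)))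
      simpa only [mul_one, toIoo, intervalIntegral.integral_zero] using this
    have tb : Tendsto (fun n => μ Set.univ ^ ((2 : ENNReal).toReal⁻¹) *
        ENNReal.ofReal (∫ z in (0 : ℝ)..L, |h' n z - G z|)) atTop (𝓝 0) := by
      have t := ENNReal.tendsto_ofReal td
      rw [ENNReal.ofReal_zero] at t
      simpa using ENNReal.Tendsto.const_mul (a := μ Set.univ ^ ((2 : ENNReal).toReal⁻¹)) t
        (Or.inr (ENNReal.rpow_ne_top_of_nonneg (by norm_num) (measure_ne_top μ _)))
    refine tendsto_of_tendsto_of_tendsto_of_le_of_le tendsto_const_nhds tb (fun _ => zero_le)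
      fun n => eLpNorm_le_of_ae_bound ?_
    refine (ae_restrict_iff' measurableSet_Ioo).2 (ae_of_all _ fun z hz => ?_)
    have gi : IntegrableOn G (Set.Ioo 0 L) := hGm.integrable (by norm_num)
    have gi' : IntervalIntegrable G volume 0 L :=
      (intervalIntegrable_iff_integrableOn_Ioo_of_le hL.le).2 gi
    have ki := fun u v => (sm' n).continuous.intervalIntegrable (μ := volume) u v
    have hzI : z ∈ Set.uIcc 0 L := Set.mem_uIcc.2 (Or.inl ⟨hz.1.le, hz.2.le⟩)
    have gz : IntervalIntegrable G volume 0 z := gi'.mono_set (Set.uIcc_subset_uIcc_left hzI)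
    have gz' : IntervalIntegrable G volume z L := gi'.mono_set (Set.uIcc_subset_uIcc_right hzI)
    rw [← intervalIntegral.integral_sub (ki 0 z) gz]
    refine (intervalIntegral.norm_integral_le_integral_norm hz.1.le).trans ?_
    rw [← intervalIntegral.integral_add_adjacent_intervals (f := fun s => |h' n s - G s|)
      (((ki 0 z).sub gz).norm) (((ki z L).sub gz').norm)]
    have := intervalIntegral.integral_nonneg (μ := volume) hz.2.le
      (fun s _ => norm_nonneg (h' n s - G s))
    exact le_add_of_nonneg_right this

/-! ### The shear flow of a profile satisfies the boundary conditions -/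

/-- The free integrand `F` serves the slope itself and its weighted powers at once. The condition
F(0, s) = 0 removes the part below `a`. -/
theorem integral_slope {a z : ℝ} (ha : 0 ≤ a) (hz : 0 ≤ z) {g : ℝ → ℝ}
    (F : ℝ → ℝ → ℝ) (hF : Continuous fun s => F (g s) s) (hF0 : ∀ s, F 0 s = 0) :
    IntervalIntegrable (fun s => F (slope a g s) s) volume 0 z ∧
    ∫ s in (0 : ℝ)..z, F (slope a g s) s = if a < z then ∫ s in a..z, F (g s) s else 0 := by
  have low : ∀ y ≤ a, Set.EqOn (fun s => F (slope a g s) s) (fun _ => 0) (Set.Ioc 0 y) :=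
    fun y hy s hs => by
      beta_reduce
      rw [slope, if_neg (not_lt.2 (hs.2.trans hy)), hF0]
  have lowI : ∀ y, 0 ≤ y → y ≤ a → IntervalIntegrable (fun s => F (slope a g s) s) volume 0 y ∧
      ∫ s in (0 : ℝ)..y, F (slope a g s) s = 0 := fun y hy0 hy => by
    constructor
    · rw [intervalIntegrable_iff_integrableOn_Ioc_of_le hy0]
      exact (integrableOn_congr_fun (low y hy) measurableSet_Ioc).2 (by simp)
    · rw [intervalIntegral.integral_of_le hy0,
        setIntegral_congr_fun measurableSet_Ioc (low y hy), integral_zero]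
  split_ifs with h
  · have up : Set.EqOn (fun s => F (slope a g s) s) (fun s => F (g s) s) (Set.Ioc a z) :=
      fun s hs => by
        beta_reduce
        rw [slope, if_pos hs.1]
    have upI : IntervalIntegrable (fun s => F (slope a g s) s) volume a z := by
      rw [intervalIntegrable_iff_integrableOn_Ioc_of_le h.le]
      exact (integrableOn_congr_fun up measurableSet_Ioc).2
        ((intervalIntegrable_iff_integrableOn_Ioc_of_le h.le).1 (hF.intervalIntegrable _ _))
    obtain ⟨i1, e1⟩ := lowI a ha le_rfl
    refine ⟨i1.trans upI, ?_⟩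
    rw [← intervalIntegral.integral_add_adjacent_intervals i1 upI, e1, zero_add,
      intervalIntegral.integral_of_le h.le, intervalIntegral.integral_of_le h.le,
      setIntegral_congr_fun measurableSet_Ioc up]
  · exact lowI z hz (not_lt.1 h)

/-- Horizontal fields depending on the height only. -/
theorem jac_horizontal {h h' : ℝ → ℝ} (hd : ∀ z, HasDerivAt h (h' z) z) (x : R3) :
    jac (fun x => ![h (x 2), 0, 0]) x = fun i k => if i = 0 ∧ k = 2 then h' (x 2) else 0 := by
  have h1 : HasFDerivAt (fun y : R3 => h (y 2))
      (h' (x 2) • ContinuousLinearMap.proj (R := ℝ) (φ := fun _ : Fin 3 => ℝ) 2) x :=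
    (hd (x 2)).comp_hasFDerivAt (f := fun y : R3 => y 2) x
      (ContinuousLinearMap.proj (R := ℝ) (φ := fun _ : Fin 3 => ℝ) 2).hasFDerivAt
  have h2 : HasFDerivAt (fun y : R3 => (![h (y 2), 0, 0] : R3)) (ContinuousLinearMap.pi
      ![h' (x 2) • ContinuousLinearMap.proj (R := ℝ) (φ := fun _ : Fin 3 => ℝ) 2, 0, 0]) x := by
    rw [hasFDerivAt_pi]
    intro i
    fin_cases i
    · exact h1
    · exact hasFDerivAt_const 0 x
    · exact hasFDerivAt_const 0 x
  ext i k
  simp only [jac, h2.fderiv]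
  fin_cases i <;> fin_cases k <;> simp

theorem norm_horizontal_le (c : ℝ) : ‖(![c, 0, 0] : R3)‖ ≤ ‖c‖ := by
  rw [pi_norm_le_iff_of_nonneg (norm_nonneg _)]
  intro i; fin_cases i <;> simp

theorem norm_entry_le (c : ℝ) :
    ‖(fun i k => if i = 0 ∧ k = 2 then c else 0 : M3)‖ ≤ ‖c‖ := by
  rw [pi_norm_le_iff_of_nonneg (norm_nonneg _)]
  intro i
  rw [pi_norm_le_iff_of_nonneg (norm_nonneg _)]
  intro k
  split_ifs <;> simp

/-- Minus the linear shear, the profile is the primitive of a bounded function of mean zero, so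
`exists_smooth_primitive_approx` supplies the approximants. The jump of the slope at `a` is harmless
in L². -/
theorem isH1Shear_shearField {L U a : ℝ} (hL : 0 < L) (ha : 0 ≤ a) (haL : a < L) {g : ℝ → ℝ}
    (hg : Continuous g) (hU : ∫ z in a..L, g z = U) :
    IsH1Shear L U (shearField a g) (shearGrad a g) := by
  obtain ⟨C, hC⟩ := exists_bound_slope (a := a) (L := L) hg
  have hsi : ∀ z, 0 ≤ z → IntervalIntegrable (slope a g) volume 0 z ∧
      ∫ s in (0 : ℝ)..z, slope a g s = profile a g z := fun z hz =>
    integral_slope ha hz (fun c _ => c) hg (fun _ => rfl)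
  set G : ℝ → ℝ := fun z => slope a g z - U / L with hG
  have hGm : Measurable G := (slope_measurable hg).sub_const _
  have hGi : ∀ z, 0 ≤ z → ∫ s in (0 : ℝ)..z, G s = profile a g z - U * z / L := fun z hz => by
    rw [intervalIntegral.integral_sub (hsi z hz).1 intervalIntegrable_const, (hsi z hz).2,
      intervalIntegral.integral_const, smul_eq_mul]
    ring
  have hGb : ∀ z ∈ Set.Ioo 0 L, |G z| ≤ C + |U / L| := fun z hz =>
    (abs_sub _ _).trans (add_le_add_left (hC z ⟨hz.1.le, hz.2.le⟩) _)
  have hG0 : ∫ z in (0 : ℝ)..L, G z = 0 := by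
    rw [hGi L hL.le, profile, if_pos haL, hU]
    field_simp
    ring
  obtain ⟨h, h', sm, sm', hd, hv, t1, t2⟩ := exists_smooth_primitive_approx hL hGm hGb hG0
  have jlin : ∀ x, jac (linearShear L U) x = fun i k => if i = 0 ∧ k = 2 then U / L else 0 :=
    fun x => jac_horizontal (h := fun z => U * z / L) (h' := fun _ => U / L) (fun z => by
      simpa using ((hasDerivAt_id z).const_mul U).div_const L) x
  have efield : ∀ x, shearField a g x - linearShear L U x =
      ![profile a g (x 2) - U * x 2 / L, 0, 0] := fun x => by
    ext i; fin_cases i <;> simp [shearField, linearShear]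
  have egrad : ∀ x, shearGrad a g x - jac (linearShear L U) x =
      fun i k => if i = 0 ∧ k = 2 then G (x 2) else 0 := fun x => by
    rw [jlin]
    ext i k
    simp only [shearGrad, Pi.sub_apply, hG]
    split_ifs <;> simp
  have hPc : Continuous fun z => profile a g z - U * z / L :=
    (profile_continuous hg).sub (by fun_prop)
  refine ⟨?_, ?_, fun n x => ![h n (x 2), 0, 0], fun n => ⟨?_, ?_, ?_⟩, ?_, ?_⟩
  · simp only [efield]
    rw [memLp_pi_iff]
    intro i
    fin_cases i
    · exact memLp_box_of_continuous (hPc.comp (continuous_apply 2))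
    · exact memLp_const 0
    · exact memLp_const 0
  · simp only [egrad]
    rw [memLp_pi_iff]
    intro i
    rw [memLp_pi_iff]
    intro k
    by_cases hik : i = 0 ∧ k = 2
    · simp only [if_pos hik]
      exact MemLp.of_bound (hGm.comp (measurable_pi_apply 2)).aestronglyMeasurable (C + |U / L|)
        ((ae_restrict_iff' (measurableSet_box L)).2 (ae_of_all _ fun x hx => hGb _ (hx 2)))
    · simp only [if_neg hik]
      exact memLp_const 0
  · rw [contDiff_pi]
    intro i
    fin_cases i
    · exact (sm n).comp (contDiff_apply ℝ ℝ (2 : Fin 3))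
    · exact contDiff_const
    · exact contDiff_const
  · intro x
    constructor <;> simp
  · obtain ⟨α, β, hα, hβ, hz⟩ := hv n
    refine ⟨α, β, hα, hβ, fun x hx => ?_⟩
    beta_reduce
    rw [hz _ hx]
    ext i; fin_cases i <;> rfl
  · have tb := ENNReal.Tendsto.const_mul (a := (ENNReal.ofReal L ^ 2) ^ (1 / 2 : ℝ)) t1
      (Or.inr (ENNReal.rpow_ne_top_of_nonneg (by norm_num) (by simp)))
    rw [mul_zero] at tb
    refine tendsto_of_tendsto_of_tendsto_of_le_of_le tendsto_const_nhds tb (fun _ => zero_le)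
      fun n => ?_
    beta_reduce
    have hm : AEStronglyMeasurable (fun z => h n z - (profile a g z - U * z / L))
        (volume.restrict (Set.Ioo 0 L)) :=
      ((sm n).continuous.sub hPc).aestronglyMeasurable
    have e : eLpNorm (fun z => h n z - ∫ s in (0 : ℝ)..z, G s) 2 (volume.restrict (Set.Ioo 0 L)) =
        eLpNorm (fun z => h n z - (profile a g z - U * z / L)) 2
          (volume.restrict (Set.Ioo 0 L)) := by
      refine eLpNorm_congr_ae ((ae_restrict_iff' measurableSet_Ioo).2 (ae_of_all _ fun z hz => ?_))
      beta_reduce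
      rw [hGi z hz.1.le]
    rw [e, ← eLpNorm_height hm]
    refine eLpNorm_mono fun x => ?_
    rw [efield]
    refine le_trans (le_of_eq ?_) (norm_horizontal_le _)
    congr 1
    ext i; fin_cases i <;> simp
  · have tb := ENNReal.Tendsto.const_mul (a := (ENNReal.ofReal L ^ 2) ^ (1 / 2 : ℝ)) t2
      (Or.inr (ENNReal.rpow_ne_top_of_nonneg (by norm_num) (by simp)))
    rw [mul_zero] at tb
    refine tendsto_of_tendsto_of_tendsto_of_le_of_le tendsto_const_nhds tb (fun _ => zero_le)
      fun n => ?_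
    beta_reduce
    have hm : AEStronglyMeasurable (fun z => h' n z - G z) (volume.restrict (Set.Ioo 0 L)) :=
      (sm' n).continuous.aestronglyMeasurable.sub hGm.aestronglyMeasurable
    rw [← eLpNorm_height hm]
    refine eLpNorm_mono fun x => ?_
    rw [egrad, jac_horizontal (hd n)]
    refine le_trans (le_of_eq ?_) (norm_entry_le _)
    congr 1
    ext i k
    simp only [Pi.sub_apply]
    split_ifs <;> simp

theorem divFree_shearGrad (L a : ℝ) (g : ℝ → ℝ) : DivFree L (shearGrad a g) :=
  ae_of_all _ fun x => by simp [shearGrad, Fin.sum_univ_three]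

/-! ### Ensemble averages -/

section Ensemble

variable {J : ℕ}

theorem ensAvg_add (a b : Fin J → ℝ) : ensAvg (fun j => a j + b j) = ensAvg a + ensAvg b := by
  simp only [ensAvg, Finset.sum_add_distrib, mul_add]

theorem ensAvg_const_mul (c : ℝ) (a : Fin J → ℝ) : ensAvg (fun j => c * a j) = c * ensAvg a := by
  simp only [ensAvg, ← Finset.mul_sum]; ring

theorem ensAvg_const (hJ : 0 < J) (c : ℝ) : ensAvg (fun _ : Fin J => c) = c := by
  have : (J : ℝ) ≠ 0 := by exact_mod_cast hJ.ne'
  simp [ensAvg]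
  field_simp

theorem ensAvg_mono {a b : Fin J → ℝ} (h : ∀ j, a j ≤ b j) : ensAvg a ≤ ensAvg b :=
  mul_le_mul_of_nonneg_left (Finset.sum_le_sum fun j _ => h j) (by positivity)

theorem ensAvg_nonneg {a : Fin J → ℝ} (h : ∀ j, 0 ≤ a j) : 0 ≤ ensAvg a :=
  mul_nonneg (by positivity) (Finset.sum_nonneg fun j _ => h j)

theorem integrable_ensAvg {α : Type*} [MeasurableSpace α] {m : Measure α} {f : Fin J → α → ℝ}
    (hf : ∀ j, Integrable (f j) m) : Integrable (fun x => ensAvg fun j => f j x) m :=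
  (integrable_finsetSum _ fun j _ => hf j).const_mul _

theorem integral_ensAvg {α : Type*} [MeasurableSpace α] {m : Measure α} {f : Fin J → α → ℝ}
    (hf : ∀ j, Integrable (f j) m) :
    ∫ x, ensAvg (fun j => f j x) ∂m = ensAvg fun j => ∫ x, f j x ∂m := by
  simp only [ensAvg]
  rw [integral_const_mul, integral_finsetSum _ fun j _ => hf j]

theorem intervalIntegral_ensAvg {a b : ℝ} {f : Fin J → ℝ → ℝ}
    (hf : ∀ j, IntervalIntegrable (f j) volume a b) :
    ∫ t in a..b, ensAvg (fun j => f j t) = ensAvg fun j => ∫ t in a..b, f j t := by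
  simp only [ensAvg]
  rw [intervalIntegral.integral_const_mul, intervalIntegral.integral_finsetSum fun j _ => hf j]

/-- The two sides differ by J(m - c)², where m is the mean. -/
theorem sum_sq_sub_mean_le (hJ : 0 < J) (a : Fin J → ℝ) (c : ℝ) :
    ∑ j, (a j - ensAvg a) * (a j - ensAvg a) ≤ ∑ j, (a j - c) * (a j - c) := by
  have hJ' : (0 : ℝ) < J := by exact_mod_cast hJ
  have hs : ∑ j, a j = J * ensAvg a := by
    simp only [ensAvg]; field_simp
  set m := ensAvg a
  have : ∑ j, (a j - c) * (a j - c) - ∑ j, (a j - m) * (a j - m) = J * (m - c) ^ 2 := by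
    rw [← Finset.sum_sub_distrib]
    have e : ∀ j, (a j - c) * (a j - c) - (a j - m) * (a j - m) =
        2 * (m - c) * a j + (c ^ 2 - m ^ 2) := fun j => by ring
    simp only [e, Finset.sum_add_distrib, ← Finset.mul_sum, hs]
    simp
    ring
  nlinarith [mul_nonneg hJ'.le (sq_nonneg (m - c))]

/-- The fluctuation is taken about the ensemble mean, which minimises the mean square. Any fixed
vector may replace the mean; the wall velocity is the choice to which the Poincaré inequality
applies. -/
theorem fluctSq_le (hJ : 0 < J) (u : Fin J → ℝ → R3 → R3) (t : ℝ) (x : R3) (c : R3) :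
    fluctSq u t x ≤ ensAvg fun j => dot (fun i => u j t x i - c i) (fun i => u j t x i - c i) := by
  simp only [fluctSq, dot, fluct]
  refine mul_le_mul_of_nonneg_left ?_ (by positivity)
  rw [Finset.sum_comm, Finset.sum_comm (f := fun j i => (u j t x i - c i) * (u j t x i - c i))]
  exact Finset.sum_le_sum fun i _ => sum_sq_sub_mean_le hJ (fun j => u j t x i) (c i)

theorem fluctSq_nonneg (u : Fin J → ℝ → R3 → R3) (t : ℝ) (x : R3) : 0 ≤ fluctSq u t x :=
  ensAvg_nonneg fun _ => dot_self_nonneg _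

theorem nuTurb_nonneg {μ : R3 → ℝ} (hμ : ∀ x, 0 ≤ μ x) {τ : ℝ} (hτ : 0 ≤ τ)
    (u : Fin J → ℝ → R3 → R3) (t : ℝ) (x : R3) : 0 ≤ nuTurb μ τ u t x :=
  mul_nonneg (mul_nonneg (hμ x) hτ) (fluctSq_nonneg u t x)

theorem integrable_fluctSq {α : Type*} [MeasurableSpace α] {m : Measure α}
    {u : Fin J → ℝ → R3 → R3} {s : α → ℝ} {X : α → R3}
    (h : ∀ j i, MemLp (fun p => u j (s p) (X p) i) 2 m) :
    Integrable (fun p => fluctSq u (s p) (X p)) m := by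
  have hf : ∀ j i, MemLp (fun p => fluct u j (s p) (X p) i) 2 m := fun j i => by
    have h1 : MemLp (fun p => ∑ k, u k (s p) (X p) i) 2 m := memLp_finsetSum _ fun k _ => h k i
    have h2 : MemLp (fun p => (1 / (J : ℝ)) * ∑ k, u k (s p) (X p) i) 2 m := h1.const_mul _
    exact (h j i).sub h2
  exact integrable_ensAvg fun j => integrable_finsetSum _ fun i _ =>
    (hf j i).integrable_mul (hf j i)

theorem integrable_nuTurb {α : Type*} [MeasurableSpace α] {m : Measure α}
    {u : Fin J → ℝ → R3 → R3} {s : α → ℝ} {X : α → R3}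
    (h : ∀ j i, MemLp (fun p => u j (s p) (X p) i) 2 m) (hX : Measurable X) {μ : R3 → ℝ}
    (hμm : Measurable μ) {M : ℝ} (hμM : ∀ x, |μ x| ≤ M) (τ : ℝ) :
    Integrable (fun p => nuTurb μ τ u (s p) (X p)) m := by
  have e : ∀ p, nuTurb μ τ u (s p) (X p) = μ (X p) * (τ * fluctSq u (s p) (X p)) := fun p => by
    simp only [nuTurb, mul_assoc]
  simp only [e]
  exact ((integrable_fluctSq h).const_mul τ).bdd_mul (c := M)
    (hμm.comp hX).aestronglyMeasurable (ae_of_all _ fun p => hμM _)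

end Ensemble

/-- `n` stands for the turbulent viscosity, which is only integrable, and the gradient is controlled
only with that weight. Young's inequality n|DG| ≤ n(E + C²)/2 suffices, and makes the background
flow admissible in the energy inequality. -/
theorem integrable_viscosity_mul {α : Type*} [MeasurableSpace α] {m : Measure α} [IsFiniteMeasure m]
    {n E D G : α → ℝ} {ν C : ℝ} (hn0 : ∀ x, 0 ≤ n x) (hn : Integrable n m)
    (hE : Integrable (fun x => n x * E x) m) (hD : MemLp D 2 m) (hDE : ∀ x, D x * D x ≤ E x)
    (hG : AEStronglyMeasurable G m) (hGC : ∀ᵐ x ∂m, |G x| ≤ C) :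
    Integrable (fun x => (ν + n x) * (D x * G x)) m := by
  have i1 : Integrable (fun x => D x * G x) m := by
    have := (hD.integrable (by norm_num)).bdd_mul (c := C) hG hGC
    simpa only [mul_comm] using this
  have i2 : Integrable (fun x => n x * (D x * G x)) m := by
    refine ((hE.const_mul (1 / 2)).add (hn.const_mul (C ^ 2 / 2))).mono'
      (hn.1.mul i1.1) ?_
    filter_upwards [hGC] with x hx
    have h1 : G x ^ 2 ≤ C ^ 2 := by
      rw [← sq_abs]; exact pow_le_pow_left₀ (abs_nonneg _) hx 2
    rw [norm_mul, Real.norm_of_nonneg (hn0 x), Real.norm_eq_abs]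
    have h2 : |D x * G x| ≤ (1 / 2) * E x + C ^ 2 / 2 := by
      rw [abs_le]
      constructor <;>
        nlinarith [hDE x, sq_nonneg (D x + G x), sq_nonneg (D x - G x)]
    calc n x * |D x * G x| ≤ n x * ((1 / 2) * E x + C ^ 2 / 2) :=
          mul_le_mul_of_nonneg_left h2 (hn0 x)
      _ = _ := by simp only [Pi.add_apply]; ring
  have := (i1.const_mul ν).add i2
  refine this.congr (ae_of_all _ fun x => ?_)
  simp only [Pi.add_apply]; ring

/-! ### The estimate at a fixed time -/

section Slice

variable {J : ℕ} {L U ν τ : ℝ} {μ : R3 → ℝ} {u : Fin J → ℝ → R3 → R3} {Du : Fin J → ℝ → R3 → M3}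

theorem slope_bound_box {a : ℝ} {g : ℝ → ℝ} {C : ℝ} (hC : ∀ z ∈ Set.Icc 0 L, |slope a g z| ≤ C) :
    ∀ᵐ x ∂((volume : Measure R3).restrict (box L)), |slope a g (x 2)| ≤ C :=
  (ae_restrict_iff' (measurableSet_box L)).2 (ae_of_all _ fun _ hx =>
      hC _ ⟨(hx 2).1.le, (hx 2).2.le⟩)

theorem slope_aestronglyMeasurable_box {a : ℝ} {g : ℝ → ℝ} (hg : Continuous g) :
    AEStronglyMeasurable (fun x : R3 => slope a g (x 2)) (volume.restrict (box L)) :=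
  ((slope_measurable hg).comp (measurable_pi_apply 2)).aestronglyMeasurable

/-- The two viscosities get different Young weights: the molecular one spends a quarter of its
dissipation, the turbulent one half. The remaining turbulent term ½ν_turb·slope² is quadratic in the
deviation from the wall velocity, so weighted Poincaré with weight slope² returns it to ∫|∇u|². -/
theorem integral_cross_le (hJ : 0 < J) (hL : 0 < L) (hν : 0 < ν) (hτ : 0 < τ)
    (hμm : Measurable μ) (hμ0 : ∀ x, 0 ≤ μ x) {M : ℝ} (hμM : ∀ x, μ x ≤ M) {a m : ℝ}
    (hm : ∀ x ∈ box L, a < x 2 → μ x ≤ m) (hm0 : 0 ≤ m)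
    {g : ℝ → ℝ} (hg : Continuous g) {t : ℝ}
    (hS : ∀ j, IsH1Shear L U (u j t) (Du j t))
    (hI : ∀ j, IntegrableOn (fun x => nuTurb μ τ u t x * frob (Du j t x) (Du j t x)) (box L))
    (j : Fin J) :
    ∫ x in box L, (ν + nuTurb μ τ u t x) * frob (Du j t x) (shearGrad a g x) ≤
      (ν / 4) * (∫ x in box L, frob (Du j t x) (Du j t x)) +
      ν * (∫ x in box L, slope a g (x 2) ^ 2) +
      (1 / 2) * (∫ x in box L, nuTurb μ τ u t x * frob (Du j t x) (Du j t x)) +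
      (1 / 2) * (m * τ) * (∫ z in (0 : ℝ)..L, slope a g z ^ 2 * (L - z)) *
        ensAvg fun i => ∫ x in box L, frob (Du i t x) (Du i t x) := by
  obtain ⟨C, hC⟩ := exists_bound_slope (a := a) (L := L) hg
  have sb := slope_bound_box hC
  have sm := slope_aestronglyMeasurable_box (L := L) (a := a) hg
  have n0 := nuTurb_nonneg hμ0 hτ.le u t
  have hnu : Integrable (fun x => nuTurb μ τ u t x) (volume.restrict (box L)) :=
    integrable_nuTurb (s := fun _ => t) (X := fun x => x) (fun j i => (hS j).memLp_coord i)
      measurable_id hμm (M := M) (fun x => by rw [abs_of_nonneg (hμ0 x)]; exact hμM x) τ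
  have P : ∀ i, _ := fun i => (hS i).integral_weight_dot_le hL
    (ρ := fun z => slope a g z ^ 2) ((slope_measurable hg).pow_const 2) (C := C ^ 2)
    (fun _ => sq_nonneg _) (fun z hz => by
      rw [← sq_abs]; exact pow_le_pow_left₀ (abs_nonneg _) (hC z hz) 2)
  have iL := integrable_viscosity_mul (ν := ν) n0 hnu (hI j) ((hS j).memLp_grad 0 2)
    (fun x => sq_le_frob (Du j t x) 0 2) sm sb
  have i1 := (hS j).integrableOn_frob
  have i2 : IntegrableOn (fun x : R3 => slope a g (x 2) ^ 2) (box L) := by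
    refine Integrable.of_bound (sm.pow 2) (C ^ 2) ?_
    filter_upwards [sb] with x hx
    rw [norm_pow]
    exact pow_le_pow_left₀ (norm_nonneg _) hx 2
  have i4 := integrable_ensAvg fun i => (P i).1
  have i12 : IntegrableOn (fun x => (ν / 4) * frob (Du j t x) (Du j t x) +
      ν * slope a g (x 2) ^ 2) (box L) := (i1.const_mul (ν / 4)).add (i2.const_mul ν)
  have i3 := (hI j).const_mul (1 / 2)
  have i123 : IntegrableOn (fun x => (ν / 4) * frob (Du j t x) (Du j t x) +
      ν * slope a g (x 2) ^ 2 +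
      (1 / 2) * (nuTurb μ τ u t x * frob (Du j t x) (Du j t x))) (box L) := i12.add i3
  have i4' := i4.const_mul ((1 / 2) * (m * τ))
  have h1 : ∫ x in box L, (ν + nuTurb μ τ u t x) * frob (Du j t x) (shearGrad a g x) ≤
      ∫ x in box L, ((ν / 4) * frob (Du j t x) (Du j t x) + ν * slope a g (x 2) ^ 2 +
        (1 / 2) * (nuTurb μ τ u t x * frob (Du j t x) (Du j t x)) +
        (1 / 2) * (m * τ) * ensAvg fun i => slope a g (x 2) ^ 2 *
          dot (fun k => u i t x k - wallVel U k) (fun k => u i t x k - wallVel U k)) := by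
    simp only [frob_shearGrad]
    refine integral_mono_ae iL (i123.add i4') ?_
    refine (ae_restrict_iff' (measurableSet_box L)).2 (ae_of_all _ fun x hx => ?_)
    have hD := sq_le_frob (Du j t x) 0 2
    have hF := fluctSq_le hJ u t x (wallVel U)
    have hF0 := fluctSq_nonneg u t x
    have hn := n0 x
    -- Below height `a` the slope vanishes, so only the bound `m` for the coefficient above `a`
    -- enters.
    have k1 : nuTurb μ τ u t x * slope a g (x 2) ^ 2 ≤
        (m * τ) * ensAvg fun i => slope a g (x 2) ^ 2 *
          dot (fun k => u i t x k - wallVel U k) (fun k => u i t x k - wallVel U k) := by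
      rw [ensAvg_const_mul]
      by_cases hax : a < x 2
      · have hmx := hm x hx hax
        calc nuTurb μ τ u t x * slope a g (x 2) ^ 2
            = μ x * τ * fluctSq u t x * slope a g (x 2) ^ 2 := rfl
          _ ≤ m * τ * (ensAvg fun j => dot (fun i => u j t x i - wallVel U i)
                (fun i => u j t x i - wallVel U i)) * slope a g (x 2) ^ 2 := by
              have := (fluctSq_nonneg u t x).trans hF
              gcongr
          _ = _ := by ring
      · have : slope a g (x 2) = 0 := by rw [slope, if_neg hax]
        rw [this]; simp
    have k2 : (ν + nuTurb μ τ u t x) * (Du j t x 0 2 * slope a g (x 2)) ≤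
        (ν / 4) * frob (Du j t x) (Du j t x) + ν * slope a g (x 2) ^ 2 +
        (1 / 2) * (nuTurb μ τ u t x * frob (Du j t x) (Du j t x)) +
        (1 / 2) * (nuTurb μ τ u t x * slope a g (x 2) ^ 2) := by
      have a1 : Du j t x 0 2 * slope a g (x 2) ≤
          (1 / 4) * frob (Du j t x) (Du j t x) + slope a g (x 2) ^ 2 := by
        nlinarith [sq_nonneg (Du j t x 0 2 - 2 * slope a g (x 2))]
      have a2 : Du j t x 0 2 * slope a g (x 2) ≤
          (1 / 2) * frob (Du j t x) (Du j t x) + (1 / 2) * slope a g (x 2) ^ 2 := by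
        nlinarith [sq_nonneg (Du j t x 0 2 - slope a g (x 2))]
      have b1 := mul_le_mul_of_nonneg_left a1 hν.le
      have b2 := mul_le_mul_of_nonneg_left a2 hn
      linarith
    beta_reduce
    linarith
  refine h1.trans ?_
  rw [integral_add i123 i4', integral_add i12 i3, integral_add (i1.const_mul _) (i2.const_mul _),
    integral_const_mul, integral_const_mul, integral_const_mul, integral_const_mul,
    integral_ensAvg fun i => (P i).1]
  have h2 : (ensAvg fun i => ∫ x in box L, slope a g (x 2) ^ 2 *
      dot (fun k => u i t x k - wallVel U k) (fun k => u i t x k - wallVel U k)) ≤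
      (∫ z in (0 : ℝ)..L, slope a g z ^ 2 * (L - z)) *
        ensAvg fun i => ∫ x in box L, frob (Du i t x) (Du i t x) := by
    rw [← ensAvg_const_mul]
    exact ensAvg_mono fun i => (P i).2
  have h3 := mul_le_mul_of_nonneg_left h2 (show 0 ≤ (1 / 2) * (m * τ) by positivity)
  linarith

end Slice

/-! ### Integration in time -/

/-- A continuous function negative at one point is negative on an open set, which has positive
measure. This upgrades the energy estimate from almost every T to every T, as the limsup requires.
-/
theorem nonneg_of_ae_nonneg {F : ℝ → ℝ} (hF : ContinuousOn F (Set.Ioi 0))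
    (h : ∀ᵐ T ∂(volume.restrict (Set.Ioi (0 : ℝ))), 0 ≤ F T) {T : ℝ} (hT : 0 < T) : 0 ≤ F T := by
  by_contra hlt
  have ho : IsOpen (Set.Ioi (0 : ℝ) ∩ F ⁻¹' Set.Iio 0) :=
    hF.isOpen_inter_preimage isOpen_Ioi isOpen_Iio
  have hpos := ho.measure_pos volume ⟨T, hT, not_le.1 hlt⟩
  rw [ae_restrict_iff' measurableSet_Ioi, ae_iff] at h
  refine hpos.ne' (measure_mono_null ?_ h)
  rintro s ⟨hs, hs'⟩ hc
  exact absurd (hc hs) (not_le.2 hs')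

theorem continuousOn_primitive_Ioi {f : ℝ → ℝ} (hf : ∀ T > 0, IntervalIntegrable f volume 0 T) :
    ContinuousOn (fun T => ∫ t in (0 : ℝ)..T, f t) (Set.Ioi 0) := by
  intro T hT
  have hT : 0 < T := hT
  have h1 := intervalIntegral.continuousOn_primitive_interval
    ((intervalIntegrable_iff').1 (hf (T + 1) (by linarith)))
  refine (h1.continuousAt ?_).continuousWithinAt
  rw [Set.uIcc_of_le (by linarith)]
  exact Icc_mem_nhds hT (by linarith)

theorem slab_fubini {L T : ℝ} (hT : 0 < T) {F : ℝ × R3 → ℝ}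
    (h : IntegrableOn F (Set.Ioo 0 T ×ˢ box L)) :
    IntervalIntegrable (fun t => ∫ x in box L, F (t, x)) volume 0 T ∧
      ∀ᵐ t ∂(volume.restrict (Set.Ioo 0 T)), IntegrableOn (fun x => F (t, x)) (box L) := by
  unfold IntegrableOn at h
  rw [Measure.volume_eq_prod, ← Measure.prod_restrict] at h
  exact ⟨(intervalIntegrable_iff_integrableOn_Ioo_of_le hT.le).2 h.integral_prod_left,
    h.prod_right_ae⟩

theorem intervalIntegral_mono_Ioo {T : ℝ} (hT : 0 < T) {f g : ℝ → ℝ}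
    (hf : IntervalIntegrable f volume 0 T) (hg : IntervalIntegrable g volume 0 T)
    (h : ∀ᵐ t ∂(volume.restrict (Set.Ioo 0 T)), f t ≤ g t) :
    ∫ t in (0 : ℝ)..T, f t ≤ ∫ t in (0 : ℝ)..T, g t := by
  refine intervalIntegral.integral_mono_ae_restrict hT.le hf hg ?_
  rwa [Measure.restrict_congr_set Ioo_ae_eq_Icc] at h

theorem intervalIntegral_congr_Ioo {T : ℝ} (hT : 0 < T) {f g : ℝ → ℝ}
    (h : ∀ᵐ t ∂(volume.restrict (Set.Ioo 0 T)), f t = g t) :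
    ∫ t in (0 : ℝ)..T, f t = ∫ t in (0 : ℝ)..T, g t := by
  rw [intervalIntegral.integral_of_le hT.le, intervalIntegral.integral_of_le hT.le,
    integral_Ioc_eq_integral_Ioo, integral_Ioc_eq_integral_Ioo]
  exact integral_congr_ae h

section TimeIntegration

variable {J : ℕ} {L U ν τ : ℝ} {μ : R3 → ℝ} {u0 : Fin J → R3 → R3} {u : Fin J → ℝ → R3 → R3}
  {Du : Fin J → ℝ → R3 → M3}

/-- `∫_Ω |∇u_j|²` at time `t`. -/
noncomputable def gradInt (L : ℝ) (Du : Fin J → ℝ → R3 → M3) (j : Fin J) (t : ℝ) : ℝ :=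
  ∫ x in box L, frob (Du j t x) (Du j t x)

/-- `∫_Ω ν_turb |∇u_j|²` at time `t`. -/
noncomputable def turbInt (L τ : ℝ) (μ : R3 → ℝ) (u : Fin J → ℝ → R3 → R3)
    (Du : Fin J → ℝ → R3 → M3) (j : Fin J) (t : ℝ) : ℝ :=
  ∫ x in box L, nuTurb μ τ u t x * frob (Du j t x) (Du j t x)

namespace IsWeakSolution

theorem integrableOn_frob (hu : IsWeakSolution L U ν τ μ u0 u Du) {T : ℝ} (hT : 0 < T)
    (j : Fin J) :
    IntegrableOn (fun p : ℝ × R3 => frob (Du j p.1 p.2) (Du j p.1 p.2))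
      (Set.Ioo 0 T ×ˢ box L) :=
  integrable_finsetSum _ fun i _ => integrable_finsetSum _ fun k _ =>
    (((hu.grad_memLp j T hT).eval i).eval k).integrable_mul
      (((hu.grad_memLp j T hT).eval i).eval k)

theorem intervalIntegrable_gradInt (hu : IsWeakSolution L U ν τ μ u0 u Du) {T : ℝ} (hT : 0 < T)
    (j : Fin J) : IntervalIntegrable (gradInt L Du j) volume 0 T :=
  (slab_fubini hT (hu.integrableOn_frob hT j)).1

theorem intervalIntegrable_turbInt (hu : IsWeakSolution L U ν τ μ u0 u Du) {T : ℝ} (hT : 0 < T)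
    (j : Fin J) : IntervalIntegrable (turbInt L τ μ u Du j) volume 0 T :=
  (slab_fubini hT (hu.turb_integrable j T hT)).1

/-- The properties of almost every time slice. -/
theorem ae_slice (hu : IsWeakSolution L U ν τ μ u0 u Du) {T : ℝ} (hT : 0 < T) :
    ∀ᵐ t ∂(volume.restrict (Set.Ioo 0 T)), (∀ j, IsH1Shear L U (u j t) (Du j t)) ∧
      (∀ j, DivFree L (Du j t)) ∧
      ∀ j, IntegrableOn (fun x => nuTurb μ τ u t x * frob (Du j t x) (Du j t x)) (box L) := by
  have s : Set.Ioo 0 T ⊆ Set.Ioi (0 : ℝ) := fun t ht => ht.1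
  have h1 := ae_restrict_of_ae_restrict_of_subset s (ae_all_iff.2 hu.shear)
  have h2 := ae_restrict_of_ae_restrict_of_subset s (ae_all_iff.2 hu.divFree)
  have h3 := ae_all_iff.2 fun j => (slab_fubini hT (hu.turb_integrable j T hT)).2
  filter_upwards [h1, h2, h3] with t a b c using ⟨a, b, c⟩

theorem ae_dissipation_eq (hu : IsWeakSolution L U ν τ μ u0 u Du) {T : ℝ} (hT : 0 < T) :
    ∀ᵐ t ∂(volume.restrict (Set.Ioo 0 T)), ∀ j,
      ∫ x in box L, (ν + nuTurb μ τ u t x) * frob (Du j t x) (Du j t x) =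
        ν * gradInt L Du j t + turbInt L τ μ u Du j t := by
  filter_upwards [hu.ae_slice hT] with t ht j
  simp only [add_mul]
  rw [integral_add ((ht.1 j).integrableOn_frob.const_mul ν) (ht.2.2 j), integral_const_mul]
  rfl

theorem integral_gradSq (hu : IsWeakSolution L U ν τ μ u0 u Du) {T : ℝ} (hT : 0 < T) :
    ∫ t in (0 : ℝ)..T, gradSq L Du t =
      (1 / L ^ 3) * ensAvg fun j => ∫ t in (0 : ℝ)..T, gradInt L Du j t := by
  have e : ∀ t, gradSq L Du t = (1 / L ^ 3) * ensAvg fun j => gradInt L Du j t := fun t =>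
    ensAvg_const_mul _ _
  simp only [e]
  rw [intervalIntegral.integral_const_mul,
    intervalIntegral_ensAvg fun j => hu.intervalIntegrable_gradInt hT j]

theorem intervalIntegrable_gradSq (hu : IsWeakSolution L U ν τ μ u0 u Du) {T : ℝ} (hT : 0 < T) :
    IntervalIntegrable (gradSq L Du) volume 0 T := by
  rw [intervalIntegrable_iff_integrableOn_Ioo_of_le hT.le]
  exact integrable_ensAvg fun j => ((intervalIntegrable_iff_integrableOn_Ioo_of_le hT.le).1
    (hu.intervalIntegrable_gradInt hT j)).const_mul _

theorem ae_epsModel_eq (hu : IsWeakSolution L U ν τ μ u0 u Du) {T : ℝ} (hT : 0 < T) :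
    ∀ᵐ t ∂(volume.restrict (Set.Ioo 0 T)), epsModel L ν τ μ u Du t =
      (1 / L ^ 3) * ensAvg fun j => ν * gradInt L Du j t + turbInt L τ μ u Du j t := by
  filter_upwards [hu.ae_dissipation_eq hT] with t ht
  simp only [epsModel, ht]
  exact ensAvg_const_mul _ _

theorem intervalIntegrable_epsModel (hu : IsWeakSolution L U ν τ μ u0 u Du) {T : ℝ}
    (hT : 0 < T) : IntervalIntegrable (epsModel L ν τ μ u Du) volume 0 T := by
  rw [intervalIntegrable_iff_integrableOn_Ioo_of_le hT.le]
  have h : IntegrableOn (fun t => (1 / L ^ 3) * ensAvg fun j =>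
      ν * gradInt L Du j t + turbInt L τ μ u Du j t) (Set.Ioo 0 T) :=
    (integrable_ensAvg fun j => (((intervalIntegrable_iff_integrableOn_Ioo_of_le hT.le).1
      (hu.intervalIntegrable_gradInt hT j)).const_mul ν).add
        ((intervalIntegrable_iff_integrableOn_Ioo_of_le hT.le).1
      (hu.intervalIntegrable_turbInt hT j))).const_mul _
  exact h.congr ((hu.ae_epsModel_eq hT).mono fun t ht => ht.symm)

theorem integral_epsModel (hu : IsWeakSolution L U ν τ μ u0 u Du) {T : ℝ} (hT : 0 < T) :
    ∫ t in (0 : ℝ)..T, epsModel L ν τ μ u Du t =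
      (1 / L ^ 3) * ensAvg fun j => ν * (∫ t in (0 : ℝ)..T, gradInt L Du j t) +
        ∫ t in (0 : ℝ)..T, turbInt L τ μ u Du j t := by
  rw [intervalIntegral_congr_Ioo hT (hu.ae_epsModel_eq hT), intervalIntegral.integral_const_mul,
    intervalIntegral_ensAvg fun j => ((hu.intervalIntegrable_gradInt hT j).const_mul ν).add
      (hu.intervalIntegrable_turbInt hT j)]
  congr 2
  ext j
  rw [intervalIntegral.integral_add ((hu.intervalIntegrable_gradInt hT j).const_mul ν)
    (hu.intervalIntegrable_turbInt hT j), intervalIntegral.integral_const_mul]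

theorem integral_gradSq_le (hL : 0 < L) (hτ : 0 ≤ τ) (hμ0 : ∀ x, 0 ≤ μ x)
    (hu : IsWeakSolution L U ν τ μ u0 u Du) {T : ℝ} (hT : 0 < T) :
    ν * (∫ t in (0 : ℝ)..T, gradSq L Du t) ≤ ∫ t in (0 : ℝ)..T, epsModel L ν τ μ u Du t := by
  rw [hu.integral_gradSq hT, hu.integral_epsModel hT, mul_left_comm, ← ensAvg_const_mul]
  refine mul_le_mul_of_nonneg_left (ensAvg_mono fun j => ?_) (by positivity)
  refine le_add_of_nonneg_right (intervalIntegral.integral_nonneg hT.le fun t _ => ?_)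
  exact integral_nonneg fun x => mul_nonneg (nuTurb_nonneg hμ0 hτ u t x) (frob_self_nonneg _)

theorem le_integral_gradSq (hJ : 0 < J) (hL : 0 < L) (hu : IsWeakSolution L U ν τ μ u0 u Du)
    {T : ℝ} (hT : 0 < T) : (U / L) ^ 2 * T ≤ ∫ t in (0 : ℝ)..T, gradSq L Du t := by
  have h : ∫ t in (0 : ℝ)..T, (U / L) ^ 2 ≤ ∫ t in (0 : ℝ)..T, gradSq L Du t := by
    refine intervalIntegral_mono_Ioo hT intervalIntegrable_const
      (hu.intervalIntegrable_gradSq hT) ?_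
    filter_upwards [hu.ae_slice hT] with t ht
    rw [← ensAvg_const hJ ((U / L) ^ 2)]
    refine ensAvg_mono fun j => ?_
    have := (ht.1 j).le_integral_frob hL
    rw [div_mul_eq_mul_div, one_mul, le_div_iff₀ (by positivity)]
    refine le_trans (le_of_eq ?_) this
    field_simp
  rw [intervalIntegral.integral_const, smul_eq_mul, sub_zero] at h
  linarith

end IsWeakSolution

end TimeIntegration

/-! ### The energy estimate -/

section EnergyEstimate

variable {J : ℕ} {L U ν τ : ℝ} {μ : R3 → ℝ} {u0 : Fin J → R3 → R3} {u : Fin J → ℝ → R3 → R3}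
  {Du : Fin J → ℝ → R3 → M3}

theorem integrable_dot {α : Type*} [MeasurableSpace α] {m : Measure α} {v w : α → R3}
    (hv : ∀ i, MemLp (fun x => v x i) 2 m) (hw : ∀ i, MemLp (fun x => w x i) 2 m) :
    Integrable (fun x => dot (v x) (w x)) m :=
  integrable_finsetSum _ fun i _ => (hv i).integrable_mul (hw i)

/-- By Young's inequality, ½‖u(T)‖² on the left of the energy inequality absorbs (u(T), φ), leaving
a bound independent of T. -/
theorem integral_dot_sub_le {α : Type*} [MeasurableSpace α] {m : Measure α} {v w : α → R3}
    (hv : ∀ i, MemLp (fun x => v x i) 2 m) (hw : ∀ i, MemLp (fun x => w x i) 2 m) :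
    (∫ x, dot (v x) (w x) ∂m) - (1 / 2) * ∫ x, dot (v x) (v x) ∂m ≤
      (1 / 2) * ∫ x, dot (w x) (w x) ∂m := by
  rw [← integral_const_mul, ← integral_const_mul,
    ← integral_sub (integrable_dot hv hw) ((integrable_dot hv hv).const_mul _)]
  refine integral_mono ((integrable_dot hv hw).sub ((integrable_dot hv hv).const_mul _))
    ((integrable_dot hw hw).const_mul _) fun x => ?_
  simp only [dot, Fin.sum_univ_three]
  nlinarith [sq_nonneg (v x 0 - w x 0), sq_nonneg (v x 1 - w x 1), sq_nonneg (v x 2 - w x 2)]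

namespace IsWeakSolution

theorem integrableOn_cross (hτ : 0 < τ) (hμm : Measurable μ) (hμ0 : ∀ x, 0 ≤ μ x) {M : ℝ}
    (hμM : ∀ x, μ x ≤ M) (hu : IsWeakSolution L U ν τ μ u0 u Du) {T : ℝ} (hT : 0 < T) {a : ℝ}
    {g : ℝ → ℝ} (hg : Continuous g) (j : Fin J) :
    IntegrableOn (fun p : ℝ × R3 =>
      (ν + nuTurb μ τ u p.1 p.2) * frob (Du j p.1 p.2) (shearGrad a g p.2))
      (Set.Ioo 0 T ×ˢ box L) := by
  obtain ⟨C, hC⟩ := exists_bound_slope (a := a) (L := L) hg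
  have hms : MeasurableSet (Set.Ioo 0 T ×ˢ box L) := measurableSet_Ioo.prod (measurableSet_box L)
  have fin : IsFiniteMeasure ((volume : Measure (ℝ × R3)).restrict (Set.Ioo 0 T ×ˢ box L)) := by
    rw [Measure.volume_eq_prod, ← Measure.prod_restrict]; infer_instance
  simp only [frob_shearGrad]
  have hn : Integrable (fun p : ℝ × R3 => nuTurb μ τ u p.1 p.2)
      (volume.restrict (Set.Ioo 0 T ×ˢ box L)) :=
    integrable_nuTurb (fun j i => (hu.memLp j T hT).eval i) measurable_snd hμm (M := M)
      (fun x => by rw [abs_of_nonneg (hμ0 x)]; exact hμM x) τ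
  have hD : MemLp (fun p : ℝ × R3 => Du j p.1 p.2 0 2) 2
      (volume.restrict (Set.Ioo 0 T ×ˢ box L)) := ((hu.grad_memLp j T hT).eval 0).eval 2
  have hG : AEStronglyMeasurable (fun p : ℝ × R3 => slope a g (p.2 2))
      (volume.restrict (Set.Ioo 0 T ×ˢ box L)) :=
    ((slope_measurable hg).comp
      ((measurable_pi_apply 2).comp measurable_snd)).aestronglyMeasurable
  have hb : ∀ᵐ p ∂((volume : Measure (ℝ × R3)).restrict (Set.Ioo 0 T ×ˢ box L)),
      |slope a g (p.2 2)| ≤ C := (ae_restrict_iff' hms).2 (ae_of_all _ fun p hp =>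
        hC _ ⟨(hp.2 2).1.le, (hp.2 2).2.le⟩)
  exact integrable_viscosity_mul (fun p => nuTurb_nonneg hμ0 hτ.le u p.1 p.2) hn
    (hu.turb_integrable j T hT) hD (fun p => sq_le_frob (Du j p.1 p.2) 0 2) hG hb

theorem integrableOn_convect (hu : IsWeakSolution L U ν τ μ u0 u Du) {T : ℝ} (hT : 0 < T) {a : ℝ}
    {g : ℝ → ℝ} (hg : Continuous g) (j : Fin J) :
    IntegrableOn (fun p : ℝ × R3 =>
      dot (convect (u j p.1 p.2) (Du j p.1 p.2)) (shearField a g p.2))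
      (Set.Ioo 0 T ×ˢ box L) := by
  obtain ⟨C, hC⟩ := exists_bound_profile (a := a) (L := L) hg
  have hms : MeasurableSet (Set.Ioo 0 T ×ˢ box L) := measurableSet_Ioo.prod (measurableSet_box L)
  have e : ∀ p : ℝ × R3, dot (convect (u j p.1 p.2) (Du j p.1 p.2)) (shearField a g p.2) =
      profile a g (p.2 2) * ∑ k, u j p.1 p.2 k * Du j p.1 p.2 0 k := fun p => by
    simp [dot, convect, shearField, Fin.sum_univ_three, mul_comm]
  simp only [e]
  refine Integrable.bdd_mul (c := C) (integrable_finsetSum _ fun k _ =>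
    ((hu.memLp j T hT).eval k).integrable_mul (((hu.grad_memLp j T hT).eval 0).eval k)) ?_ ?_
  · exact ((profile_continuous hg).comp
      ((continuous_apply 2).comp continuous_snd)).aestronglyMeasurable
  · exact (ae_restrict_iff' hms).2 (ae_of_all _ fun p hp =>
      hC _ ⟨(hp.2 2).1.le, (hp.2 2).2.le⟩)

/-- Inserts the slice estimates for the viscous cross term and the convective term into the energy
inequality of one realization. The turbulent viscosity couples the realizations, hence the ensemble
average on the right. -/
theorem ae_energy_bound (hJ : 0 < J) (hL : 0 < L) (hν : 0 < ν) (hτ : 0 < τ)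
    (hμm : Measurable μ) (hμ0 : ∀ x, 0 ≤ μ x) {M : ℝ} (hμM : ∀ x, μ x ≤ M)
    (hu : IsWeakSolution L U ν τ μ u0 u Du) (hE : EnergyInequality L U ν τ μ u0 u Du)
    {a m : ℝ} (ha : 0 ≤ a) (haL : a < L) (hm : ∀ x ∈ box L, a < x 2 → μ x ≤ m) (hm0 : 0 ≤ m)
    {g : ℝ → ℝ} (hg : Continuous g) (hg0 : ∀ z, 0 ≤ g z) (hgU : ∫ z in a..L, g z = U)
    (j : Fin J) :
    ∃ C, ∀ᵐ T ∂(volume.restrict (Set.Ioi (0 : ℝ))),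
      ν * (∫ t in (0 : ℝ)..T, gradInt L Du j t) + ∫ t in (0 : ℝ)..T, turbInt L τ μ u Du j t ≤
      C + (ν / 4 + (1 / 2) * ∫ z in (0 : ℝ)..L, slope a g z * (L - z)) *
          (∫ t in (0 : ℝ)..T, gradInt L Du j t) +
        (1 / 2) * (∫ t in (0 : ℝ)..T, turbInt L τ μ u Du j t) +
        (1 / 2) * (m * τ) * (∫ z in (0 : ℝ)..L, slope a g z ^ 2 * (L - z)) *
          (ensAvg fun i => ∫ t in (0 : ℝ)..T, gradInt L Du i t) +
        ν * (∫ x in box L, slope a g (x 2) ^ 2) * T := by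
  set φ := shearField a g with hφ
  have hS := isH1Shear_shearField hL ha haL hg hgU
  have cross := fun T (hT : 0 < T) =>
    hu.integrableOn_cross hτ hμm hμ0 hμM hT (a := a) hg j
  have conv := fun T (hT : 0 < T) => hu.integrableOn_convect hT (a := a) hg j
  have ineq := hE j φ (shearGrad a g) hS (divFree_shearGrad L a g) cross conv
  -- Everything that does not depend on T: the initial terms and the remainder of (u(T), φ) -
  -- ½‖u(T)‖².
  refine ⟨(1 / 2) * (∫ x in box L, dot (φ x) (φ x)) + (1 / 2) * (∫ x in box L, dot (u0 j x) (u0 j x))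
    - ∫ x in box L, dot (u0 j x) (φ x), ?_⟩
  filter_upwards [ineq, hu.shear j, ae_restrict_mem measurableSet_Ioi] with T h1 hT1 hT
  have hT : 0 < T := hT
  have e1 : ∫ t in (0 : ℝ)..T, ∫ x in box L,
      (ν + nuTurb μ τ u t x) * frob (Du j t x) (Du j t x) =
      ν * (∫ t in (0 : ℝ)..T, gradInt L Du j t) + ∫ t in (0 : ℝ)..T, turbInt L τ μ u Du j t := by
    rw [intervalIntegral_congr_Ioo hT ((hu.ae_dissipation_eq hT).mono fun t ht => ht j),
      intervalIntegral.integral_add ((hu.intervalIntegrable_gradInt hT j).const_mul ν)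
        (hu.intervalIntegrable_turbInt hT j), intervalIntegral.integral_const_mul]
  have e2 := integral_dot_sub_le (m := volume.restrict (box L)) (fun i => hT1.memLp_coord i)
    (fun i => hS.memLp_coord i)
  set κ := (1 / 2) * ∫ z in (0 : ℝ)..L, slope a g z * (L - z)
  set S := ν * (∫ x in box L, slope a g (x 2) ^ 2)
  set K := (1 / 2) * (m * τ) * (∫ z in (0 : ℝ)..L, slope a g z ^ 2 * (L - z))
  have iA := hu.intervalIntegrable_gradInt hT j
  have iD := hu.intervalIntegrable_turbInt hT j
  have iE : IntervalIntegrable (fun t => ensAvg fun i => gradInt L Du i t) volume 0 T := by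
    rw [intervalIntegrable_iff_integrableOn_Ioo_of_le hT.le]
    exact integrable_ensAvg fun i => (intervalIntegrable_iff_integrableOn_Ioo_of_le hT.le).1
      (hu.intervalIntegrable_gradInt hT i)
  have iR := (slab_fubini hT (cross T hT)).1
  have iN := (slab_fubini hT (conv T hT)).1
  have e3 : (∫ t in (0 : ℝ)..T, ∫ x in box L,
        (ν + nuTurb μ τ u t x) * frob (Du j t x) (shearGrad a g x)) ≤
      ∫ t in (0 : ℝ)..T, ((ν / 4) * gradInt L Du j t + S + (1 / 2) * turbInt L τ μ u Du j t +
        K * ensAvg fun i => gradInt L Du i t) := by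
    refine intervalIntegral_mono_Ioo hT iR ((((iA.const_mul _).add intervalIntegrable_const).add
      (iD.const_mul _)).add (iE.const_mul _)) ?_
    filter_upwards [hu.ae_slice hT] with t ht
    exact integral_cross_le hJ hL hν hτ hμm hμ0 hμM hm hm0 hg ht.1 ht.2.2 j
  clear_value S K
  rw [intervalIntegral.integral_add (((iA.const_mul _).add intervalIntegrable_const).add
      (iD.const_mul _)) (iE.const_mul _),
    intervalIntegral.integral_add ((iA.const_mul _).add intervalIntegrable_const) (iD.const_mul _),
    intervalIntegral.integral_add (iA.const_mul _) intervalIntegrable_const,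
    intervalIntegral.integral_const_mul, intervalIntegral.integral_const_mul,
    intervalIntegral.integral_const_mul, intervalIntegral.integral_const, smul_eq_mul, sub_zero,
    intervalIntegral_ensAvg fun i => hu.intervalIntegrable_gradInt hT i] at e3
  have e4 : (∫ t in (0 : ℝ)..T, ∫ x in box L, dot (convect (u j t x) (Du j t x)) (φ x)) ≤
      κ * ∫ t in (0 : ℝ)..T, gradInt L Du j t := by
    rw [← intervalIntegral.integral_const_mul]
    refine intervalIntegral_mono_Ioo hT iN (iA.const_mul _) ?_
    filter_upwards [hu.ae_slice hT] with t ht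
    exact (ht.1 j).integral_convect_le hL (ht.2.1 j) ha haL.le hg hg0
  rw [e1] at h1
  linarith

/-- The energy estimate obtained from the background flow with slope `g` above height `a`. -/
theorem energy_bound (hJ : 0 < J) (hL : 0 < L) (hν : 0 < ν) (hτ : 0 < τ)
    (hμm : Measurable μ) (hμ0 : ∀ x, 0 ≤ μ x) {M : ℝ} (hμM : ∀ x, μ x ≤ M)
    (hu : IsWeakSolution L U ν τ μ u0 u Du) (hE : EnergyInequality L U ν τ μ u0 u Du)
    {a m : ℝ} (ha : 0 ≤ a) (haL : a < L) (hm : ∀ x ∈ box L, a < x 2 → μ x ≤ m) (hm0 : 0 ≤ m)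
    {g : ℝ → ℝ} (hg : Continuous g) (hg0 : ∀ z, 0 ≤ g z) (hgU : ∫ z in a..L, g z = U) :
    ∃ C, ∀ T > 0, (1 / 2) * (∫ t in (0 : ℝ)..T, epsModel L ν τ μ u Du t) ≤
      C + (-(ν / 4) + (1 / 2) * (∫ z in (0 : ℝ)..L, slope a g z * (L - z)) +
        (1 / 2) * (m * τ) * (∫ z in (0 : ℝ)..L, slope a g z ^ 2 * (L - z))) *
          (∫ t in (0 : ℝ)..T, gradSq L Du t) +
        ν * (∫ x in box L, slope a g (x 2) ^ 2) / L ^ 3 * T := by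
  choose C hC using fun j =>
    hu.ae_energy_bound hJ hL hν hτ hμm hμ0 hμM hE ha haL hm hm0 hg hg0 hgU j
  refine ⟨(1 / L ^ 3) * ensAvg C, fun T hT => ?_⟩
  set κ := (1 / 2) * ∫ z in (0 : ℝ)..L, slope a g z * (L - z)
  set S := ν * (∫ x in box L, slope a g (x 2) ^ 2)
  set K := (1 / 2) * (m * τ) * (∫ z in (0 : ℝ)..L, slope a g z ^ 2 * (L - z))
  rw [← sub_nonneg]
  refine nonneg_of_ae_nonneg (F := fun T => (1 / L ^ 3) * ensAvg C +
    (-(ν / 4) + κ + K) * (∫ t in (0 : ℝ)..T, gradSq L Du t) + S / L ^ 3 * T -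
    (1 / 2) * (∫ t in (0 : ℝ)..T, epsModel L ν τ μ u Du t)) ?_ ?_ hT
  · have c1 := continuousOn_primitive_Ioi fun T hT => hu.intervalIntegrable_gradSq hT
    have c2 := continuousOn_primitive_Ioi fun T hT => hu.intervalIntegrable_epsModel hT
    exact ((continuousOn_const.add (continuousOn_const.mul c1)).add
      (continuousOn_const.mul continuousOn_id)).sub (continuousOn_const.mul c2)
  · filter_upwards [ae_all_iff.2 hC, ae_restrict_mem measurableSet_Ioi] with T h hT
    have hT : 0 < T := hT
    rw [sub_nonneg, hu.integral_gradSq hT, hu.integral_epsModel hT]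
    -- Averaging over j closes the coupled estimate. Of the ¾ν left on the gradient, ½ν and the
    -- remaining half of the turbulent part form half the dissipation; the surplus ¼ν is the term
    -- -(ν/4).
    have h2 := ensAvg_mono h
    simp only [ensAvg_add, ensAvg_const_mul, ensAvg_const hJ] at h2 ⊢
    have h3 := mul_le_mul_of_nonneg_left h2 (show 0 ≤ 1 / L ^ 3 by positivity)
    have e : S / L ^ 3 * T = (1 / L ^ 3) * (S * T) := by ring
    rw [e]
    linarith

end IsWeakSolution

end EnergyEstimate

/-! ### Long time averages -/

theorem longTimeAvg_le {f : ℝ → ℝ} {r : ℝ}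
    (h : ∀ᶠ T in atTop, (1 / T) * ∫ t in (0 : ℝ)..T, f t ≤ r) : longTimeAvg f ≤ (r : EReal) :=
  limsup_le_of_le (by isBoundedDefault) (h.mono fun _ hT => EReal.coe_le_coe_iff.2 hT)

theorem le_longTimeAvg {f : ℝ → ℝ} {r : ℝ}
    (h : ∀ᶠ T in atTop, r ≤ (1 / T) * ∫ t in (0 : ℝ)..T, f t) : (r : EReal) ≤ longTimeAvg f :=
  le_limsup_of_frequently_le (h.mono fun _ hT => EReal.coe_le_coe_iff.2 hT).frequently
    (by isBoundedDefault)

theorem eventually_lt_of_longTimeAvg_lt {f : ℝ → ℝ} {r : ℝ} (h : longTimeAvg f < (r : EReal)) :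
    ∀ᶠ T in atTop, (1 / T) * ∫ t in (0 : ℝ)..T, f t < r :=
  (eventually_lt_of_limsup_lt h (by isBoundedDefault)).mono fun _ hT => EReal.coe_lt_coe_iff.1 hT

/-! ### Integrals of the slope -/

theorem integral_slope_top {a L : ℝ} (ha : 0 ≤ a) (haL : a < L) {g : ℝ → ℝ} (hg : Continuous g) :
    ∫ z in (0 : ℝ)..L, slope a g z * (L - z) = ∫ z in a..L, g z * (L - z) := by
  have := (integral_slope (z := L) ha (ha.trans haL.le) (g := g) (fun c s => c * (L - s))
    (by fun_prop) (fun s => by simp)).2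
  rwa [if_pos haL] at this

theorem integral_slope_sq_top {a L : ℝ} (ha : 0 ≤ a) (haL : a < L) {g : ℝ → ℝ}
    (hg : Continuous g) :
    ∫ z in (0 : ℝ)..L, slope a g z ^ 2 * (L - z) = ∫ z in a..L, g z ^ 2 * (L - z) := by
  have := (integral_slope (z := L) ha (ha.trans haL.le) (g := g) (fun c s => c ^ 2 * (L - s))
    (by fun_prop) (fun s => by simp)).2
  rwa [if_pos haL] at this

theorem integral_box_slope_sq {a L : ℝ} (ha : 0 ≤ a) (haL : a < L) {g : ℝ → ℝ}
    (hg : Continuous g) :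
    ∫ x in box L, slope a g (x 2) ^ 2 = L ^ 2 * ∫ z in a..L, g z ^ 2 := by
  have := (integral_slope (z := L) ha (ha.trans haL.le) (g := g) (fun c _ => c ^ 2)
    (by fun_prop) (fun s => by simp)).2
  rw [if_pos haL] at this
  rw [← this, ← integral_height (ha.trans haL.le) (F := fun z => slope a g z ^ 2)]
  exact ((slope_measurable hg).pow_const 2).aestronglyMeasurable

theorem integral_sub_id (a L : ℝ) : ∫ z in a..L, (L - z) = (L - a) ^ 2 / 2 := by
  rw [intervalIntegral.integral_sub intervalIntegrable_const intervalIntegral.intervalIntegrable_id,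
    intervalIntegral.integral_const, integral_id,
    smul_eq_mul]
  ring

/-- A logarithmic profile, whose weighted energies are as small as desired. -/
theorem exists_log_profile {L U ℓ : ℝ} (hL : 0 < L) (hU : 0 < U) (hℓ : 0 < ℓ) :
    ∃ g : ℝ → ℝ, Continuous g ∧ (∀ z, 0 ≤ g z) ∧ ∫ z in (0 : ℝ)..L, g z = U ∧
      ∫ z in (0 : ℝ)..L, g z * (L - z) ≤ U * L / ℓ ∧
      ∫ z in (0 : ℝ)..L, g z ^ 2 * (L - z) ≤ U ^ 2 / ℓ := by
  have hexp : 0 < Real.exp ℓ - 1 := by linarith [Real.add_one_lt_exp hℓ.ne']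
  -- Chosen so that log((L + δ)/δ) = ℓ, which makes the integral of the slope equal to U.
  set δ := L / (Real.exp ℓ - 1) with hδ
  have hδ0 : 0 < δ := div_pos hL hexp
  have den : ∀ z : ℝ, 0 < max (L - z) 0 + δ := fun z => by
    have := le_max_right (L - z) 0; linarith
  -- The maximum keeps the slope continuous and nonnegative above z = L.
  set g : ℝ → ℝ := fun z => U / ℓ * (max (L - z) 0 + δ)⁻¹ with hg
  have hgc : Continuous g := by
    refine continuous_const.mul (Continuous.inv₀ (by fun_prop) fun z => (den z).ne')
  have hg0 : ∀ z, 0 ≤ g z := fun z => by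
    have := den z
    positivity
  have hgI : ∫ z in (0 : ℝ)..L, g z = U := by
    have hd : ∀ z ∈ Set.uIcc 0 L,
        HasDerivAt (fun z => -(U / ℓ) * Real.log (L - z + δ)) (g z) z := fun z hz => by
      rw [Set.uIcc_of_le hL.le] at hz
      have hp : 0 < L - z + δ := by linarith [hz.2]
      have h1 : HasDerivAt (fun z => L - z + δ) (-1) z := by
        simpa using ((hasDerivAt_id z).const_sub L).add_const δ
      have h2 := (h1.log hp.ne').const_mul (-(U / ℓ))
      refine h2.congr_deriv ?_
      simp only [hg]
      rw [max_eq_left (by linarith [hz.2])]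
      field_simp
    rw [intervalIntegral.integral_eq_sub_of_hasDerivAt hd (hgc.intervalIntegrable _ _)]
    have e : L + δ = Real.exp ℓ * δ := by
      rw [hδ]; field_simp; ring
    rw [sub_self, zero_add, sub_zero, e, Real.log_mul (Real.exp_pos _).ne' hδ0.ne', Real.log_exp]
    field_simp
    ring
  -- This one pointwise bound gives both weighted integrals: integrate it alone, or against `g`,
  -- whose integral is U.
  have hbd : ∀ z ∈ Set.Icc 0 L, g z * (L - z) ≤ U / ℓ := fun z hz => by
    have hp : 0 < L - z + δ := by linarith [hz.2]
    simp only [hg]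
    rw [max_eq_left (by linarith [hz.2]), mul_assoc]
    refine mul_le_of_le_one_right (by positivity) ?_
    rw [inv_mul_le_iff₀ hp]
    linarith
  refine ⟨g, hgc, hg0, hgI, ?_, ?_⟩
  · have := intervalIntegral.integral_mono_on (μ := volume) hL.le
      (Continuous.intervalIntegrable (by fun_prop) _ _) intervalIntegrable_const hbd
    refine this.trans (le_of_eq ?_)
    rw [intervalIntegral.integral_const, smul_eq_mul]
    ring
  · have : ∫ z in (0 : ℝ)..L, g z ^ 2 * (L - z) ≤ ∫ z in (0 : ℝ)..L, U / ℓ * g z := by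
      refine intervalIntegral.integral_mono_on hL.le
        (Continuous.intervalIntegrable (by fun_prop) _ _)
        (Continuous.intervalIntegrable (by fun_prop) _ _) fun z hz => ?_
      have := mul_le_mul_of_nonneg_left (hbd z hz) (hg0 z)
      linarith
    refine this.trans (le_of_eq ?_)
    rw [intervalIntegral.integral_const_mul, hgI]
    ring

/-! ### The wall coefficient -/

theorem measurable_muWall (L β μ₀ μβ : ℝ) : Measurable (muWall L β μ₀ μβ) := by
  have h : MeasurableSet (nearWall L β) := by
    unfold nearWall
    measurability
  unfold muWall
  exact Measurable.ite h measurable_const measurable_const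

theorem muWall_nonneg {L β μ₀ μβ : ℝ} (h0 : 0 ≤ μ₀) (hβ : 0 ≤ μβ) (x : R3) :
    0 ≤ muWall L β μ₀ μβ x := by
  unfold muWall; split_ifs <;> assumption

theorem muWall_le (L β μ₀ μβ : ℝ) (x : R3) : muWall L β μ₀ μβ x ≤ max μ₀ μβ := by
  unfold muWall; split_ifs
  · exact le_max_right _ _
  · exact le_max_left _ _

theorem muWall_of_mem {L β μ₀ μβ : ℝ} {x : R3} (hx : x ∈ box L) (h : (1 - β) * L < x 2) :
    muWall L β μ₀ μβ x = μβ := by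
  unfold muWall
  rw [if_pos]
  exact ⟨⟨(hx 0).1.le, (hx 0).2.le⟩, ⟨(hx 1).1.le, (hx 1).2.le⟩, h, (hx 2).2⟩

/-! ### Bounds for the long time averages -/

section Averages

variable {J : ℕ} {L U ν τ : ℝ} {μ : R3 → ℝ} {u0 : Fin J → R3 → R3} {u : Fin J → ℝ → R3 → R3}
  {Du : Fin J → ℝ → R3 → M3}

namespace IsWeakSolution

/-- A coefficient that is bounded by `m` yields a finite mean dissipation rate. -/
theorem longTimeAvg_epsModel_lt_top (hJ : 0 < J) (hL : 0 < L) (hU : 0 < U) (hν : 0 < ν)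
    (hτ : 0 < τ) (hμm : Measurable μ) (hμ0 : ∀ x, 0 ≤ μ x) {m : ℝ} (hμM : ∀ x, μ x ≤ m)
    (hu : IsWeakSolution L U ν τ μ u0 u Du) (hE : EnergyInequality L U ν τ μ u0 u Du) :
    longTimeAvg (epsModel L ν τ μ u Du) < ⊤ := by
  have hm0 : 0 ≤ m := (hμ0 0).trans (hμM 0)
  -- With this value the bounds for the convective and turbulent contributions add up to exactly
  -- ν/4, so the gradient coefficient is nonpositive without smallness of `m`.
  set ℓ := 2 * (U * L + m * τ * U ^ 2) / ν with hℓ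
  have hℓ0 : 0 < ℓ := by positivity
  obtain ⟨g, hg, hg0, hgU, h1, h2⟩ := exists_log_profile hL hU hℓ0
  obtain ⟨C, hC⟩ := hu.energy_bound hJ hL hν hτ hμm hμ0 hμM hE le_rfl hL
    (fun x _ _ => hμM x) hm0 hg hg0 hgU
  rw [integral_slope_top le_rfl hL hg, integral_slope_sq_top le_rfl hL hg] at hC
  set c := ν * (∫ x in box L, slope 0 g (x 2) ^ 2) / L ^ 3
  have hκ : -(ν / 4) + (1 / 2) * (∫ z in (0 : ℝ)..L, g z * (L - z)) +
      (1 / 2) * (m * τ) * (∫ z in (0 : ℝ)..L, g z ^ 2 * (L - z)) ≤ 0 := by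
    have h3 := mul_le_mul_of_nonneg_left h2 (show 0 ≤ (1 / 2) * (m * τ) by positivity)
    have h4 : (1 / 2) * (U * L / ℓ) + (1 / 2) * (m * τ) * (U ^ 2 / ℓ) = ν / 4 := by
      have : ℓ * ν = 2 * (U * L + m * τ * U ^ 2) := by rw [hℓ]; field_simp
      field_simp
      linarith
    linarith
  refine lt_of_le_of_lt (longTimeAvg_le (r := 2 * |C| + 2 * c) ?_) (EReal.coe_lt_top _)
  filter_upwards [eventually_ge_atTop 1] with T hT
  have hT0 : 0 < T := by linarith
  have h5 := hC T hT0
  have h6 : 0 ≤ ∫ t in (0 : ℝ)..T, gradSq L Du t :=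
    le_trans (by positivity) (hu.le_integral_gradSq hJ hL hT0)
  have h7 := mul_nonpos_of_nonpos_of_nonneg hκ h6
  rw [one_div_mul_eq_div, div_le_iff₀ hT0]
  have h8 : C ≤ |C| * T := (le_abs_self C).trans (le_mul_of_one_le_right (abs_nonneg _) hT)
  linarith

/-- The mean dissipation rate and the mean squared gradient are finite and positive, and
their ratio is at least the kinematic viscosity. -/
theorem exists_longTimeAvg_eq (hJ : 0 < J) (hL : 0 < L) (hU : 0 < U) (hν : 0 < ν) (hτ : 0 < τ)
    (hμ0 : ∀ x, 0 ≤ μ x) (hu : IsWeakSolution L U ν τ μ u0 u Du)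
    (hfin : longTimeAvg (epsModel L ν τ μ u Du) < ⊤) :
    ∃ e d : ℝ, longTimeAvg (epsModel L ν τ μ u Du) = e ∧ longTimeAvg (gradSq L Du) = d ∧
      0 < d ∧ ν * d ≤ e := by
  have hd1 : (((U / L) ^ 2 : ℝ) : EReal) ≤ longTimeAvg (gradSq L Du) := by
    refine le_longTimeAvg ?_
    filter_upwards [eventually_gt_atTop 0] with T hT
    rw [one_div_mul_eq_div, le_div_iff₀ hT]
    exact hu.le_integral_gradSq hJ hL hT
  have cmp : ∀ T > 0, ν * ((1 / T) * ∫ t in (0 : ℝ)..T, gradSq L Du t) ≤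
      (1 / T) * ∫ t in (0 : ℝ)..T, epsModel L ν τ μ u Du t := fun T hT => by
    rw [mul_left_comm]
    exact mul_le_mul_of_nonneg_left (hu.integral_gradSq_le hL hτ.le hμ0 hT) (by positivity)
  have he1 : ((ν * (U / L) ^ 2 : ℝ) : EReal) ≤ longTimeAvg (epsModel L ν τ μ u Du) := by
    refine le_longTimeAvg ?_
    filter_upwards [eventually_gt_atTop 0] with T hT
    refine le_trans (mul_le_mul_of_nonneg_left ?_ hν.le) (cmp T hT)
    rw [one_div_mul_eq_div, le_div_iff₀ hT]
    exact hu.le_integral_gradSq hJ hL hT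
  obtain ⟨e, he⟩ : ∃ e : ℝ, longTimeAvg (epsModel L ν τ μ u Du) = e :=
    ⟨_, (EReal.coe_toReal hfin.ne ((EReal.bot_lt_coe _).trans_le he1).ne').symm⟩
  -- Comparison with any r above e bounds the mean squared gradient by r/ν. This first yields its
  -- finiteness, then νd ≤ e as r decreases to e.
  have hup : ∀ r : ℝ, e < r → longTimeAvg (gradSq L Du) ≤ ((r / ν : ℝ) : EReal) := by
    intro r hr
    refine longTimeAvg_le ?_
    have := eventually_lt_of_longTimeAvg_lt (he.trans_lt (EReal.coe_lt_coe_iff.2 hr))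
    filter_upwards [this, eventually_gt_atTop 0] with T h1 hT
    rw [le_div_iff₀ hν]
    linarith [cmp T hT]
  obtain ⟨d, hd⟩ : ∃ d : ℝ, longTimeAvg (gradSq L Du) = d :=
    ⟨_, (EReal.coe_toReal ((hup (e + 1) (by linarith)).trans_lt (EReal.coe_lt_top _)).ne
      ((EReal.bot_lt_coe _).trans_le hd1).ne').symm⟩
  rw [hd] at hd1 hup
  refine ⟨e, d, he, hd, lt_of_lt_of_le (by positivity) (EReal.coe_le_coe_iff.1 hd1), ?_⟩
  refine le_of_forall_gt_imp_ge_of_dense fun r hr => ?_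
  have := EReal.coe_le_coe_iff.1 (hup r hr)
  rw [le_div_iff₀ hν] at this
  linarith

/-- The bound for the mean dissipation rate obtained from the linear profile in the slab. -/
theorem longTimeAvg_epsModel_le (hJ : 0 < J) (hL : 0 < L) (hU : 0 < U) (hν : 0 < ν) (hτ : 0 < τ)
    (hμm : Measurable μ) (hμ0 : ∀ x, 0 ≤ μ x) {M : ℝ} (hμM : ∀ x, μ x ≤ M)
    (hu : IsWeakSolution L U ν τ μ u0 u Du) (hE : EnergyInequality L U ν τ μ u0 u Du)
    {β m : ℝ} (hβ0 : 0 < β) (hβ1 : β ≤ 1) (hm : ∀ x ∈ box L, (1 - β) * L < x 2 → μ x ≤ m)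
    (hm0 : 0 ≤ m) (hsmall : m * τ * U ^ 2 ≤ ν) {e d : ℝ}
    (he : longTimeAvg (epsModel L ν τ μ u Du) = e) (hd : longTimeAvg (gradSq L Du) = d) :
    e ≤ (U * (β * L) / 2) * d + 2 * (ν * (U ^ 2 / (β * L ^ 2))) := by
  have ha : 0 ≤ (1 - β) * L := mul_nonneg (by linarith) hL.le
  have haL : (1 - β) * L < L := by nlinarith
  have hLa : L - (1 - β) * L = β * L := by ring
  have hc0 : 0 < U / (β * L) := by positivity
  -- The slope U/(βL) is constant on the slab, where the coefficient is at most `m`.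
  obtain ⟨C, hC⟩ := hu.energy_bound hJ hL hν hτ hμm hμ0 hμM hE ha haL hm hm0
    (continuous_const (y := U / (β * L))) (fun _ => hc0.le) (by
      rw [intervalIntegral.integral_const, hLa, smul_eq_mul]; field_simp)
  rw [integral_slope_top ha haL continuous_const, integral_slope_sq_top ha haL continuous_const,
    integral_box_slope_sq ha haL continuous_const, intervalIntegral.integral_const_mul,
    intervalIntegral.integral_const_mul, integral_sub_id, intervalIntegral.integral_const, hLa,
    smul_eq_mul] at hC
  -- The turbulent contribution is mτU²/4, independent of the slab width; `hsmall` lets -ν/4 absorb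
  -- it and only the convective part UβL/4 remains.
  have hκ : -(ν / 4) + (1 / 2) * (U / (β * L) * ((β * L) ^ 2 / 2)) +
      (1 / 2) * (m * τ) * ((U / (β * L)) ^ 2 * ((β * L) ^ 2 / 2)) ≤ U * (β * L) / 4 := by
    have e1 : U / (β * L) * ((β * L) ^ 2 / 2) = U * (β * L) / 2 := by field_simp
    have e2 : (U / (β * L)) ^ 2 * ((β * L) ^ 2 / 2) = U ^ 2 / 2 := by field_simp
    rw [e1, e2]
    linarith
  have hc : ν * (L ^ 2 * (β * L * (U / (β * L)) ^ 2)) / L ^ 3 = ν * (U ^ 2 / (β * L ^ 2)) := by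
    field_simp
  rw [hc] at hC
  set κ := U * (β * L) / 4 with hκd
  have hκ0 : 0 ≤ κ := by positivity
  set c := ν * (U ^ 2 / (β * L ^ 2))
  -- One η covers both the excess of the finite time gradient average over its limsup and the
  -- vanishing term C/T.
  have main : ∀ η > 0, e ≤ 2 * (η + κ * (d + η) + c) := by
    intro η hη
    have h1 := eventually_lt_of_longTimeAvg_lt
      (hd.trans_lt (EReal.coe_lt_coe_iff.2 (show d < d + η by linarith)))
    have : longTimeAvg (epsModel L ν τ μ u Du) ≤ ((2 * (η + κ * (d + η) + c) : ℝ) : EReal) := by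
      refine longTimeAvg_le ?_
      filter_upwards [h1, eventually_gt_atTop 0, eventually_ge_atTop (C / η)] with T h1 hT hTC
      have h5 := hC T hT
      have h6 : 0 ≤ ∫ t in (0 : ℝ)..T, gradSq L Du t :=
        le_trans (by positivity) (hu.le_integral_gradSq hJ hL hT)
      have h7 := mul_le_mul_of_nonneg_right hκ h6
      rw [one_div_mul_eq_div, div_lt_iff₀ hT] at h1
      rw [one_div_mul_eq_div, div_le_iff₀ hT]
      have h8 := mul_le_mul_of_nonneg_left h1.le hκ0
      rw [div_le_iff₀ hη] at hTC
      linarith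
    rw [he] at this
    exact EReal.coe_le_coe_iff.1 this
  have lim : Tendsto (fun η : ℝ => 2 * (η + κ * (d + η) + c)) (𝓝[>] 0)
      (𝓝 (2 * (0 + κ * (d + 0) + c))) := by
    have hcont : Continuous fun η : ℝ => 2 * (η + κ * (d + η) + c) := by fun_prop
    exact (hcont.tendsto 0).mono_left nhdsWithin_le_nhds
  have := ge_of_tendsto lim (eventually_mem_nhdsWithin.mono fun η hη => main η hη)
  have e1 : U * (β * L) / 2 * d = 2 * (κ * d) := by rw [hκd]; ring
  rw [zero_add, add_zero] at this
  linarith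

end IsWeakSolution

end Averages

end ShearEEV

/-! ### The main estimate -/

theorem mainTheorem3 {J : ℕ} (hJ : 0 < J)
    (L U ν τ : ℝ) (hL : 0 < L) (hU : 0 < U) (hν : 0 < ν)
    (hτ : 0 < τ) (hτT : τ ≤ L / U)
    (μ₀ μβ β : ℝ) (hμ₀ : 0 ≤ μ₀) (hμβ : 0 ≤ μβ)
    (u0 : Fin J → ShearEEV.R3 → ShearEEV.R3)
    (u : Fin J → ℝ → ShearEEV.R3 → ShearEEV.R3)
    (Du : Fin J → ℝ → ShearEEV.R3 → ShearEEV.M3)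
    (hu : ShearEEV.IsWeakSolution L U ν τ (ShearEEV.muWall L β μ₀ μβ) u0 u Du)
    (hE : ShearEEV.EnergyInequality L U ν τ (ShearEEV.muWall L β μ₀ μβ) u0 u Du)
    (hβ : β = (1 / 8) *
      (ShearEEV.reynolds L U (ShearEEV.nuEff L ν τ (ShearEEV.muWall L β μ₀ μβ) u Du))⁻¹)
    (hβ1 : β ≤ 1)
    (hsmall : μβ ≤ 0.27064 * (ShearEEV.reynolds L U ν)⁻¹) :
    ShearEEV.longTimeAvg
        (ShearEEV.epsModel L ν τ (ShearEEV.muWall L β μ₀ μβ) u Du)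
      ≤ (((5 + 32 * (ν / ShearEEV.nuEff L ν τ (ShearEEV.muWall L β μ₀ μβ) u Du))
          * (U ^ 3 / L) : ℝ) : EReal) ∧
    (5 + 32 * (ν / ShearEEV.nuEff L ν τ (ShearEEV.muWall L β μ₀ μβ) u Du)) * (U ^ 3 / L)
      ≤ 37 * (U ^ 3 / L) := by
  have hμm := ShearEEV.measurable_muWall L β μ₀ μβ
  have hμ0 := ShearEEV.muWall_nonneg (L := L) (β := β) hμ₀ hμβ
  have hμM := ShearEEV.muWall_le L β μ₀ μβ
  have hfin := hu.longTimeAvg_epsModel_lt_top hJ hL hU hν hτ hμm hμ0 hμM hE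
  obtain ⟨e, d, he, hd, hd0, hνd⟩ := hu.exists_longTimeAvg_eq hJ hL hU hν hτ hμ0 hfin
  set N := ShearEEV.nuEff L ν τ (ShearEEV.muWall L β μ₀ μβ) u Du with hN
  have hNed : N = e / d := by rw [hN, ShearEEV.nuEff, he, hd]; rfl
  have heN : e = N * d := by rw [hNed]; field_simp
  have hνN : ν ≤ N := by rw [hNed, le_div_iff₀ hd0]; exact hνd
  have hN0 : 0 < N := hν.trans_le hνN
  have hβN : 8 * U * L * β = N := by
    rw [hβ, ShearEEV.reynolds]; field_simp
  have hβ0 : 0 < β := by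
    have h8 : 0 < 8 * U * L := by positivity
    exact (pos_iff_pos_of_mul_pos (hβN ▸ hN0)).1 h8
  -- As τU ≤ L, the left side is at most μβ·UL ≤ 0.27064ν; any constant up to 1 would do here.
  have hsm : μβ * τ * U ^ 2 ≤ ν := by
    have h1 : τ * U ≤ L := (le_div_iff₀ hU).1 hτT
    have h2 : μβ * (U * L) ≤ 0.27064 * ν := by
      rw [ShearEEV.reynolds, inv_div, ← mul_div_assoc, le_div_iff₀ (by positivity)] at hsmall
      exact hsmall
    calc μβ * τ * U ^ 2 = μβ * U * (τ * U) := by ring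
      _ ≤ μβ * U * L := by gcongr
      _ ≤ 0.27064 * ν := by linarith
      _ ≤ ν := by linarith
  have key := hu.longTimeAvg_epsModel_le hJ hL hU hν hτ hμm hμ0 hμM hE hβ0 hβ1
    (fun x hx h => (ShearEEV.muWall_of_mem hx h).le) hμβ hsm he hd
  have hUL : 0 < U ^ 3 / L := by positivity
  -- The factor 1/8 in β leaves a sixteenth of the dissipation on the right, to be absorbed on the
  -- left.
  have k1 : U * (β * L) / 2 * d = e / 16 := by rw [heN, ← hβN]; ring
  have k2 : 2 * (ν * (U ^ 2 / (β * L ^ 2))) = 16 * (ν / N) * (U ^ 3 / L) := by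
    rw [← hβN]; field_simp; norm_num
  rw [k1, k2] at key
  have hr0 : 0 < ν / N := div_pos hν hN0
  have hr1 : ν / N ≤ 1 := (div_le_one hN0).2 hνN
  have hp := mul_pos hr0 hUL
  refine ⟨?_, ?_⟩
  · rw [he, EReal.coe_le_coe_iff]
    -- From (15/16)e ≤ 16(ν/N)U³/L one gets e ≤ (256/15)(ν/N)U³/L, and 256/15 < 32.
    nlinarith
  · exact mul_le_mul_of_nonneg_right (by linarith) hUL.le
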